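/- Conventions. A hyper-Hermitian structure $(\{J_\alpha\}_{\alpha=1,2,3},g)$ on a smooth manifold consists of three integrable complex structures with $J_\alpha^2=-\mathrm{id}$, $J_1J_2=-J_2J_1=J_3$, and a Riemannian metric $g$ with $g(J_\alpha X,J_\alpha Y)=g(X,Y)$ for all $\alpha$. It is HKT if there is a connection $\nabla^B$ with $\nabla^B g=0$, $\nabla^B J_\alpha=0$ ($\alpha=1,2,3$) and such that $c(X,Y,Z)=g(X,T^B(Y,Z))$ is a 3-form, $T^B$ being the torsion of $\nabla^B$; an HKT structure is strong if $dc=0$ and weak if $dc\neq 0$. With $\omega_\alpha(X,Y)=g(J_\alpha X,Y)$, the structure is hyper-Kähler if $d\omega_\alpha=0$ for all $\alpha$, and balanced if $d^*\omega_\alpha=0$ for all $\alpha$, where $d^*$ is the adjoint of $d$ with respect to $g$. Let $G$ be a connected Lie group with Lie algebra $\mathfrak g$, let $(\{J_\alpha\},g)$ be a left-invariant hyper-Hermitian structure on $G$, and let $\pi:G\to GL(q,\mathbb H)$ be a quaternionic representation, i.e. a smooth homomorphism into the group of invertible real-linear maps of $\mathbb H^q$ commuting with left quaternionic multiplication. Let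 $T_\pi G=G\ltimes_\pi\mathbb H^q$ be the Lie group $G\times\mathbb H^q$ with product $(a,v)(b,w)=(ab,\,v+\pi(a)w)$, and let $(\{\tilde J_\alpha\},\tilde g)$ be the left-invariant structure on $T_\pi G$ given on its Lie algebra $\mathfrak g\times\mathbb H^q$ by $$\tilde J_\alpha(X,V)=(J_\alpha X,\,i_\alpha V),\qquad \tilde g\big((X,V),(Y,W)\big)=g(X,Y)+\langle V,W\rangle ,$$ where $i_1=i$, $i_2=j$, $i_3=k$ act by left multiplication and $\langle\cdot,\cdot\rangle$ is the standard real inner product of $\mathbb H^q$. Then $(\{\tilde J_\alpha\},\tilde g)$ is a left-invariant hyper-Hermitian structure on $T_\pi G$, and: 1. $(T_\pi G,\{\tilde J_\alpha\},\tilde g)$ is HKT if and only if $(G,\{J_\alpha\},g)$ is HKT and $\pi(G)\subset Sp(q)$, where $Sp(q)\subset GL(q,\mathbb H)$ is the subgroup preserving the standard quaternionic Hermitian form $\sum_i v_i\overline{w_i}$. 2. If $(T_\pi G,\{\tilde J_\alpha\},\tilde g)$ is HKT, then it is strong (respectively weak, hyper-Kähler, balanced) if and only if $(G,\{J_\alpha\},g)$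 is strong (respectively weak, hyper-Kähler, balanced). -/

import Mathlib

open scoped Manifold ContDiff Quaternion

noncomputable section

namespace HKT

/-! ## Hyper-Hermitian structures on a manifold -/

section Manifold

variable {E : Type*} [NormedAddCommGroup E] [NormedSpace ℝ E]
  {H : Type*} [TopologicalSpace H] {I : ModelWithCorners ℝ E H}
  {M : Type*} [TopologicalSpace M] [ChartedSpace H M]

/-- A (globally defined) vector field `X` on `M` is smooth. -/
def IsSmoothField [IsManifold I ∞ M] (X : (x : M) → TangentSpace I x) : Prop :=
  ContMDiff I I.tangent ∞ (fun x => (⟨x, X x⟩ : TangentBundle I M))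

variable (I M) in
/-- Three fields of endomorphisms `J 0, J 1, J 2` of the tangent spaces (the
structures `J₁, J₂, J₃`) and a field `g` of bilinear forms. The laws that make them a hyper-Hermitian
structure are collected in `TensorData.IsHyperHermitian`. -/
structure TensorData where
  J : Fin 3 → (x : M) → TangentSpace I x →ₗ[ℝ] TangentSpace I x
  g : (x : M) → TangentSpace I x →ₗ[ℝ] TangentSpace I x →ₗ[ℝ] ℝ

/-- The Nijenhuis tensor `N(X,Y) = J([X,Y] - [JX,JY]) - ([JX,Y] + [X,JY])` on vector fields. -/
def nijenhuis (J : (x : M) → TangentSpace I x →ₗ[ℝ] TangentSpace I x)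
    (X Y : (x : M) → TangentSpace I x) (x : M) : TangentSpace I x :=
  J x (VectorField.mlieBracket I X Y x
      - VectorField.mlieBracket I (fun y => J y (X y)) (fun y => J y (Y y)) x)
    - (VectorField.mlieBracket I (fun y => J y (X y)) Y x
      + VectorField.mlieBracket I X (fun y => J y (Y y)) x)

/-- Exterior derivative of a 2-form, evaluated on vector fields. -/
def extDerivTwo (η : (x : M) → TangentSpace I x → TangentSpace I x → ℝ)
    (X Y Z : (x : M) → TangentSpace I x) (x : M) : ℝ :=
  mvfderiv I (fun y => η y (Y y) (Z y)) x (X x)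
    - mvfderiv I (fun y => η y (X y) (Z y)) x (Y x)
    + mvfderiv I (fun y => η y (X y) (Y y)) x (Z x)
    - η x (VectorField.mlieBracket I X Y x) (Z x)
    + η x (VectorField.mlieBracket I X Z x) (Y x)
    - η x (VectorField.mlieBracket I Y Z x) (X x)

/-- Exterior derivative of a 3-form, evaluated on vector fields. -/
def extDerivThree (c : (x : M) → TangentSpace I x → TangentSpace I x → TangentSpace I x → ℝ)
    (X Y Z W : (x : M) → TangentSpace I x) (x : M) : ℝ :=
  mvfderiv I (fun y => c y (Y y) (Z y) (W y)) x (X x)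
    - mvfderiv I (fun y => c y (X y) (Z y) (W y)) x (Y x)
    + mvfderiv I (fun y => c y (X y) (Y y) (W y)) x (Z x)
    - mvfderiv I (fun y => c y (X y) (Y y) (Z y)) x (W x)
    - c x (VectorField.mlieBracket I X Y x) (Z x) (W x)
    + c x (VectorField.mlieBracket I X Z x) (Y x) (W x)
    - c x (VectorField.mlieBracket I X W x) (Y x) (Z x)
    - c x (VectorField.mlieBracket I Y Z x) (X x) (W x)
    + c x (VectorField.mlieBracket I Y W x) (X x) (Z x)
    - c x (VectorField.mlieBracket I Z W x) (X x) (Y x)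

variable [IsManifold I ∞ M]

/-- `dω = 0` for a 2-form. -/
def IsClosedTwo (η : (x : M) → TangentSpace I x → TangentSpace I x → ℝ) : Prop :=
  ∀ X Y Z : (x : M) → TangentSpace I x,
    IsSmoothField X → IsSmoothField Y → IsSmoothField Z →
      ∀ x, extDerivTwo η X Y Z x = 0

/-- `dc = 0` for a 3-form. -/
def IsClosedThree
    (c : (x : M) → TangentSpace I x → TangentSpace I x → TangentSpace I x → ℝ) : Prop :=
  ∀ X Y Z W : (x : M) → TangentSpace I x,
    IsSmoothField X → IsSmoothField Y → IsSmoothField Z → IsSmoothField W →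
      ∀ x, extDerivThree c X Y Z W x = 0

/-- A smooth affine connection: `∇_X Y` is smooth for smooth `X`, `Y`. In Mathlib's argument
order `∇_X Y` at `x` is `D Y x (X x)`. -/
def IsSmoothConnection (D : CovariantDerivative I E (TangentSpace I : M → Type _)) : Prop :=
  ∀ X Y : (x : M) → TangentSpace I x, IsSmoothField X → IsSmoothField Y →
    IsSmoothField (fun x => D Y x (X x))

namespace TensorData

/-- `S` is a hyper-Hermitian structure: the `J α` are smooth integrable almost complex structures
satisfying the quaternion relations, and `g` is a smooth Riemannian metric compatible with each
of them. -/
structure IsHyperHermitian (S : TensorData I M) : Prop where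
  smooth_J : ∀ (α : Fin 3) (X : (x : M) → TangentSpace I x), IsSmoothField X →
    IsSmoothField (fun x => S.J α x (X x))
  smooth_g : ∀ X Y : (x : M) → TangentSpace I x, IsSmoothField X → IsSmoothField Y →
    ContMDiff I 𝓘(ℝ, ℝ) ∞ (fun x => S.g x (X x) (Y x))
  sq_J : ∀ α x v, S.J α x (S.J α x v) = -v
  J_zero_one : ∀ x v, S.J 0 x (S.J 1 x v) = S.J 2 x v
  J_one_zero : ∀ x v, S.J 1 x (S.J 0 x v) = -S.J 2 x v
  integrable : ∀ (α : Fin 3) (X Y : (x : M) → TangentSpace I x),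
    IsSmoothField X → IsSmoothField Y → ∀ x, nijenhuis (S.J α) X Y x = 0
  g_symm : ∀ x v w, S.g x v w = S.g x w v
  g_pos : ∀ x v, v ≠ 0 → 0 < S.g x v v
  g_compat : ∀ α x v w, S.g x (S.J α x v) (S.J α x w) = S.g x v w

/-- The Kähler form `ω_α(X,Y) = g(J_α X, Y)`. -/
def kahlerForm (S : TensorData I M) (α : Fin 3) (x : M) (v w : TangentSpace I x) : ℝ :=
  S.g x (S.J α x v) w

/-- `∇g = 0`. -/
def IsMetric (S : TensorData I M)
    (D : CovariantDerivative I E (TangentSpace I : M → Type _)) : Prop :=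
  ∀ X Y Z : (x : M) → TangentSpace I x,
    IsSmoothField X → IsSmoothField Y → IsSmoothField Z →
      ∀ x, mvfderiv I (fun y => S.g y (Y y) (Z y)) x (X x)
        = S.g x (D Y x (X x)) (Z x) + S.g x (Y x) (D Z x (X x))

/-- `∇J_α = 0` for `α = 1, 2, 3`. -/
def IsQuaternionic (S : TensorData I M)
    (D : CovariantDerivative I E (TangentSpace I : M → Type _)) : Prop :=
  ∀ (α : Fin 3) (X Y : (x : M) → TangentSpace I x), IsSmoothField X → IsSmoothField Y →
    ∀ x, D (fun y => S.J α y (Y y)) x (X x) = S.J α x (D Y x (X x))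

variable [FiniteDimensional ℝ E]

/-- The torsion tensor of an affine connection. -/
def torsion (D : CovariantDerivative I E (TangentSpace I : M → Type _)) (x : M)
    (v w : TangentSpace I x) : TangentSpace I x :=
  haveI : CompleteSpace E := FiniteDimensional.complete ℝ E
  D.torsion x v w

/-- `c(X,Y,Z) = g(X, T(Y,Z))`, where `T` is the torsion of the connection. -/
def torsionForm (S : TensorData I M)
    (D : CovariantDerivative I E (TangentSpace I : M → Type _)) (x : M)
    (u v w : TangentSpace I x) : ℝ :=
  S.g x u (torsion D x v w)

/-- `D` is a hyper-Hermitian connection whose torsion tensor is a 3-form. -/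
structure IsHKTConnection (S : TensorData I M)
    (D : CovariantDerivative I E (TangentSpace I : M → Type _)) : Prop where
  smooth : IsSmoothConnection D
  metric : S.IsMetric D
  quaternionic : S.IsQuaternionic D
  skew_left : ∀ x u v w, S.torsionForm D x u v w = -S.torsionForm D x v u w
  skew_right : ∀ x u v w, S.torsionForm D x u v w = -S.torsionForm D x u w v

/-- Hyper-Kähler with torsion. -/
def IsHKT (S : TensorData I M) : Prop :=
  S.IsHyperHermitian ∧ ∃ D, S.IsHKTConnection D

/-- Strong HKT: the torsion 3-form of the HKT connection is closed. -/
def IsStrongHKT (S : TensorData I M) : Prop :=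
  S.IsHyperHermitian ∧ ∃ D, S.IsHKTConnection D ∧ IsClosedThree (S.torsionForm D)

/-- Weak HKT: the torsion 3-form of the HKT connection is not closed. -/
def IsWeakHKT (S : TensorData I M) : Prop :=
  S.IsHyperHermitian ∧ ∃ D, S.IsHKTConnection D ∧ ¬ IsClosedThree (S.torsionForm D)

/-- Hyper-Kähler: the three Kähler forms are closed. -/
def IsHyperKahler (S : TensorData I M) : Prop :=
  S.IsHyperHermitian ∧ ∀ α, IsClosedTwo (S.kahlerForm α)

/-- `D` is the Levi-Civita connection of `g`: metric and torsion-free. -/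
structure IsLeviCivita (S : TensorData I M)
    (D : CovariantDerivative I E (TangentSpace I : M → Type _)) : Prop where
  smooth : IsSmoothConnection D
  metric : S.IsMetric D
  torsion_free : ∀ x v w, torsion D x v w = 0

end TensorData

/-- The covariant derivative `(∇_X ω)(Y,Z)` of a 2-form. -/
def covDerivTwo (D : CovariantDerivative I E (TangentSpace I : M → Type _))
    (η : (x : M) → TangentSpace I x → TangentSpace I x → ℝ)
    (X Y Z : (x : M) → TangentSpace I x) (x : M) : ℝ :=
  mvfderiv I (fun y => η y (Y y) (Z y)) x (X x)
    - η x (D Y x (X x)) (Z x) - η x (Y x) (D Z x (X x))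

namespace TensorData

/-- The 2-form `ω` is coclosed, `d*ω = 0`. With `∇` the Levi-Civita connection (passed as `D`),
the adjoint `d*` of `d` is `(d*ω)(Y) = -∑ᵢ (∇_{eᵢ} ω)(eᵢ, Y)` for any `g`-orthonormal basis
`e₁, …, e_m` of the tangent space at the point considered, extended to smooth fields. -/
def IsCoclosed (S : TensorData I M)
    (D : CovariantDerivative I E (TangentSpace I : M → Type _))
    (η : (x : M) → TangentSpace I x → TangentSpace I x → ℝ) : Prop :=
  ∀ (x : M) (e : Fin (Module.finrank ℝ E) → (y : M) → TangentSpace I y)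
    (Y : (y : M) → TangentSpace I y),
    (∀ i, IsSmoothField (e i)) → IsSmoothField Y →
    (∀ i j, S.g x (e i x) (e j x) = if i = j then 1 else 0) →
      -∑ i, covDerivTwo D η (e i) (e i) Y x = 0

/-- Balanced: `d*ω_α = 0` for each of the three Hermitian structures `(J_α, g)`, with `d*` the
adjoint of `d` with respect to `g`. -/
def IsBalanced [FiniteDimensional ℝ E] (S : TensorData I M) : Prop :=
  S.IsHyperHermitian ∧ ∃ D, S.IsLeviCivita D ∧ ∀ α, S.IsCoclosed D (S.kahlerForm α)

end TensorData

end Manifold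

/-! ## Left-invariant structures on Lie groups -/

section LeftInvariant

variable {E : Type*} [NormedAddCommGroup E] [NormedSpace ℝ E]
  {H : Type*} [TopologicalSpace H] {I : ModelWithCorners ℝ E H}
  {G : Type*} [TopologicalSpace G] [ChartedSpace H G] [Group G]

/-- All left translations preserve the three endomorphism fields and the bilinear form. -/
structure TensorData.IsLeftInvariant (S : TensorData I G) : Prop where
  J_invariant : ∀ (α : Fin 3) (a x : G) (v : TangentSpace I x),
    S.J α (a * x) (mfderiv I I (a * ·) x v) = mfderiv I I (a * ·) x (S.J α x v)
  g_invariant : ∀ (a x : G) (v w : TangentSpace I x),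
    S.g (a * x) (mfderiv I I (a * ·) x v) (mfderiv I I (a * ·) x w) = S.g x v w

/-- The differential `T_eG → T_pG` at `e` of the left translation by `p`. -/
def fromIdentity (p : G) : GroupLieAlgebra I G →L[ℝ] TangentSpace I p :=
  (mfderiv I I (p * ·) (1 : G) : TangentSpace I (1 : G) →L[ℝ] TangentSpace I (p * 1))

/-- The differential `T_pG → T_eG` at `p` of the left translation by `p⁻¹`. -/
def toIdentity (p : G) : TangentSpace I p →L[ℝ] GroupLieAlgebra I G :=
  (mfderiv I I (p⁻¹ * ·) p : TangentSpace I p →L[ℝ] TangentSpace I (p⁻¹ * p))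

/-- The left-invariant tensor fields on `G` with prescribed values on the Lie algebra. -/
def leftInvariant (J₀ : Fin 3 → GroupLieAlgebra I G →ₗ[ℝ] GroupLieAlgebra I G)
    (g₀ : GroupLieAlgebra I G →ₗ[ℝ] GroupLieAlgebra I G →ₗ[ℝ] ℝ) : TensorData I G where
  J α p := (fromIdentity p).toLinearMap ∘ₗ J₀ α ∘ₗ (toIdentity p).toLinearMap
  g p := g₀.compl₁₂ (toIdentity p).toLinearMap (toIdentity p).toLinearMap

end LeftInvariant

/-! ## Quaternionic representations and the group `T_π G = G ⋉ ℍ^q` -/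

/-- `ℍ^q`, a left `ℍ`-module with its natural Euclidean inner product. -/
abbrev HSpace (q : ℕ) : Type := PiLp 2 (fun _ : Fin q => ℍ[ℝ])

/-- `GL(q,ℍ)`: the automorphisms of `ℍ^q` that commute with left quaternionic multiplication. -/
abbrev GLH (q : ℕ) : Type := LinearMap.GeneralLinearGroup ℍ[ℝ] (HSpace q)

/-- The standard quaternionic Hermitian form on `ℍ^q`. -/
def hermForm {q : ℕ} (v w : HSpace q) : ℍ[ℝ] := ∑ i, v i * star (w i)

/-- `Sp(q)`: the subgroup of `GL(q,ℍ)` preserving the standard quaternionic Hermitian form. -/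
def Sp (q : ℕ) : Subgroup (GLH q) where
  carrier := {A | ∀ v w : HSpace q, hermForm (A.val v) (A.val w) = hermForm v w}
  one_mem' := fun _ _ => rfl
  mul_mem' := by
    intro A B hA hB v w
    exact (hA (B.val v) (B.val w)).trans (hB v w)
  inv_mem' := by
    intro A hA v w
    have h := hA ((A⁻¹).val v) ((A⁻¹).val w)
    have key : ∀ u : HSpace q, A.val ((A⁻¹).val u) = u := fun u => by
      have := congrArg (fun B : GLH q => B.val u) (mul_inv_cancel A)
      exact this
    rw [key, key] at h
    exact h.symm

/-- An `ℍ`-linear endomorphism of `ℍ^q` as a real continuous linear map. -/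
def realMap {q : ℕ} (A : HSpace q →ₗ[ℍ[ℝ]] HSpace q) : HSpace q →L[ℝ] HSpace q :=
  LinearMap.toContinuousLinearMap (A.restrictScalars ℝ)

/-- Left quaternionic multiplication by `a` on `ℍ^q`. -/
def leftMul (q : ℕ) (a : ℍ[ℝ]) : HSpace q →L[ℝ] HSpace q :=
  LinearMap.toContinuousLinearMap
    { toFun := fun v => a • v
      map_add' := fun v w => smul_add a v w
      map_smul' := fun r v => smul_comm a r v }

/-- The imaginary units `i, j, k`. -/
def imagUnit : Fin 3 → ℍ[ℝ] := ![⟨0, 1, 0, 0⟩, ⟨0, 0, 1, 0⟩, ⟨0, 0, 0, 1⟩]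

section Extension

variable {E : Type*} [NormedAddCommGroup E] [NormedSpace ℝ E]
  {H : Type*} [TopologicalSpace H]

/-- A quaternionic representation of `G` on `ℍ^q`: a smooth homomorphism `G → GL(q,ℍ)`. -/
structure QuaternionicRep (I : ModelWithCorners ℝ E H) (G : Type*) [TopologicalSpace G]
    [ChartedSpace H G] [Group G] (q : ℕ) where
  toHom : G →* GLH q
  smooth : ContMDiff I 𝓘(ℝ, HSpace q →L[ℝ] HSpace q) ∞ (fun a => realMap (toHom a).val)

variable {I : ModelWithCorners ℝ E H}
  {G : Type*} [TopologicalSpace G] [ChartedSpace H G] [Group G] {q : ℕ}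

/-- The underlying manifold `G × ℍ^q` of `T_π G = G ⋉ ℍ^q`. -/
def TGroup (_π : QuaternionicRep I G q) : Type _ := G × HSpace q

namespace TGroup

variable (π : QuaternionicRep I G q)

instance : TopologicalSpace (TGroup π) := inferInstanceAs (TopologicalSpace (G × HSpace q))

instance : ChartedSpace (ModelProd H (HSpace q)) (TGroup π) :=
  inferInstanceAs (ChartedSpace (ModelProd H (HSpace q)) (G × HSpace q))

/-- The semidirect product `(a, v) (b, w) = (a b, v + π(a) w)`. -/
instance : Group (TGroup π) where
  mul p r := (p.1 * r.1, p.2 + (π.toHom p.1).val r.2)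
  one := (1, 0)
  inv p := (p.1⁻¹, -(π.toHom p.1⁻¹).val p.2)
  mul_assoc p r s := by
    refine Prod.ext (mul_assoc p.1 r.1 s.1) ?_
    change p.2 + (π.toHom p.1).val r.2 + (π.toHom (p.1 * r.1)).val s.2
      = p.2 + (π.toHom p.1).val (r.2 + (π.toHom r.1).val s.2)
    rw [map_mul, map_add, add_assoc]
    rfl
  one_mul p := by
    refine Prod.ext (one_mul p.1) ?_
    change 0 + (π.toHom 1).val p.2 = p.2
    rw [map_one, zero_add]
    rfl
  mul_one p := by
    refine Prod.ext (mul_one p.1) ?_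
    change p.2 + (π.toHom p.1).val 0 = p.2
    rw [map_zero, add_zero]
  inv_mul_cancel p := by
    refine Prod.ext (inv_mul_cancel p.1) ?_
    change -(π.toHom p.1⁻¹).val p.2 + (π.toHom p.1⁻¹).val p.2 = 0
    exact neg_add_cancel _

instance [LieGroup I ∞ G] : LieGroup (I.prod 𝓘(ℝ, HSpace q)) ∞ (TGroup π) where
  toIsManifold := inferInstanceAs (IsManifold (I.prod 𝓘(ℝ, HSpace q)) ∞ (G × HSpace q))
  contMDiff_mul := by
    have h : ContMDiff ((I.prod 𝓘(ℝ, HSpace q)).prod (I.prod 𝓘(ℝ, HSpace q)))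
        (I.prod 𝓘(ℝ, HSpace q)) ∞
        (fun p : (G × HSpace q) × (G × HSpace q) =>
          (p.1.1 * p.2.1, p.1.2 + realMap (π.toHom p.1.1).val p.2.2)) :=
      ((contMDiff_fst.comp contMDiff_fst).mul (contMDiff_fst.comp contMDiff_snd)).prodMk
        ((contMDiff_snd.comp contMDiff_fst).add
          (ContMDiff.clm_apply (π.smooth.comp (contMDiff_fst.comp contMDiff_fst))
            (contMDiff_snd.comp contMDiff_snd)))
    exact h
  contMDiff_inv := by
    have h : ContMDiff (I.prod 𝓘(ℝ, HSpace q)) (I.prod 𝓘(ℝ, HSpace q)) ∞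
        (fun p : G × HSpace q => (p.1⁻¹, -realMap (π.toHom p.1⁻¹).val p.2)) :=
      (contMDiff_fst.inv).prodMk
        (ContMDiff.clm_apply (π.smooth.comp contMDiff_fst.inv) contMDiff_snd).neg
    exact h

end TGroup

/-- The structure `({J̃_α}, g̃)` on `T_π G` extending `({J_α}, g)`. It is the left-invariant
structure given on the Lie algebra `𝔤 × ℍ^q` by `J̃_α(X, V) = (J_α X, i_α V)` and
`g̃((X, V), (Y, W)) = g(X, Y) + ⟨V, W⟩`. -/
def TensorData.extend (S : TensorData I G) (π : QuaternionicRep I G q) :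
    TensorData (I.prod 𝓘(ℝ, HSpace q)) (TGroup π) :=
  leftInvariant (I := I.prod 𝓘(ℝ, HSpace q)) (G := TGroup π)
    (fun α => (LinearMap.prodMap (S.J α (1 : G) : E →ₗ[ℝ] E)
      (leftMul q (imagUnit α)).toLinearMap : E × HSpace q →ₗ[ℝ] E × HSpace q))
    ((LinearMap.compl₁₂ (S.g (1 : G) : E →ₗ[ℝ] E →ₗ[ℝ] ℝ)
        (LinearMap.fst ℝ E (HSpace q)) (LinearMap.fst ℝ E (HSpace q))
      + LinearMap.compl₁₂ (innerₗ (HSpace q))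
        (LinearMap.snd ℝ E (HSpace q)) (LinearMap.snd ℝ E (HSpace q)) :
        E × HSpace q →ₗ[ℝ] E × HSpace q →ₗ[ℝ] ℝ))

end Extension

end HKT

end

/-! Every condition in the theorem can be decided on the Lie algebra. The tangent bundle is
trivialized by left translations, and a vector field X becomes a function `coframe X : G → E`. In
these terms [X,Y] is X(coframe Y) - Y(coframe X) plus the algebra bracket (`coframe_mlieBracket`),
so for invariant tensors all derivative terms cancel in the Nijenhuis tensor and in the exterior
derivatives. A connection D competing in the definitions need not be invariant, but its values at
one point on invariant fields (`connectionAt D p`) form a bilinear product on the Lie algebra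
satisfying the same algebraic conditions. Conversely every such product defines an invariant
connection (`invConnection`). No averaging over the group is needed.

The Lie algebra of T_π G is the semidirect product with bracket ([x,y], dπ(x)w - dπ(y)v)
(`TGroup.bracketMap_eq`), and connectedness of G turns π(G) ⊂ Sp(q) into skewness of every dπ(x)
(`QuaternionicRep.mem_Sp_iff_deriv_skew`).

If dπ is skew, the product (B_x y, dπ(x)w) is metric and quaternionic whenever B is, and its torsion
is that of B, so HKT and Levi-Civita connections extend; in the other direction they compress to the
Lie algebra of G. Skewness is forced by HKT: the torsion form of an HKT connection equals dω_α(J_α·,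
J_α·, J_α·) for each α (`LieData.IsHKTConnection.torsionForm_eq`). Let s(x; v, w) = ⟨dπ(x)v, w⟩ +
⟨v, dπ(x)w⟩. Comparing two values of α gives s(x; v, w) = s(J₃x; kv, w), whose left side is
symmetric in v, w and whose right side is skew; hence s = 0 (`LieData.IsHKTConnection.skew`).

Once dπ is skew, the forms dω_α and the torsion form of T_π G are pulled back from the Lie algebra
of G, which settles strong, weak and hyper-Kähler. For balanced, the Levi-Civita product is the
extended one by uniqueness, and d*ω_α is the trace of a quadratic form pulled back along an
orthogonal projection, hence equal to the trace on the Lie algebra of G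
(`LieData.sum_covKahler_semidirect`). -/

noncomputable section

namespace HKT

open VectorField Bundle Filter Topology

/-! ### The left-invariant trivialization of the tangent bundle of a Lie group. -/

section LieGroupCalculus

variable {E : Type*} [NormedAddCommGroup E] [NormedSpace ℝ E]
  {H : Type*} [TopologicalSpace H] {I : ModelWithCorners ℝ E H}
  {G : Type*} [TopologicalSpace G] [ChartedSpace H G] [Group G]

theorem mdifferentiable_mul_left_top [LieGroup I ∞ G] (a : G) :
    MDifferentiable I I (a * · : G → G) :=
  (contMDiff_mul_left (I := I) (n := ∞) (a := a)).mdifferentiable (by simp)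

theorem fromIdentity_toIdentity [LieGroup I ∞ G] (p : G) (v : TangentSpace I p) :
    fromIdentity p (toIdentity p v) = v := by
  have h : mfderiv I I ((p * ·) ∘ (p⁻¹ * ·) : G → G) p = ContinuousLinearMap.id _ _ := by
    have : ((p * ·) ∘ (p⁻¹ * ·) : G → G) = id := by ext x; simp
    rw [this, mfderiv_id]
  exact (mfderiv_comp_apply_of_eq (I' := I) (y := 1) p (mdifferentiable_mul_left_top p _)
    (mdifferentiable_mul_left_top p⁻¹ _) (by simp) v).symm.trans (DFunLike.congr_fun h v)

theorem toIdentity_fromIdentity [LieGroup I ∞ G] (p : G) (v : GroupLieAlgebra I G) :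
    toIdentity p (fromIdentity p v) = v := by
  have h : mfderiv I I ((p⁻¹ * ·) ∘ (p * ·) : G → G) 1 = ContinuousLinearMap.id _ _ := by
    have : ((p⁻¹ * ·) ∘ (p * ·) : G → G) = id := by ext x; simp
    rw [this, mfderiv_id]
  exact (mfderiv_comp_apply_of_eq (I' := I) (y := p) (1 : G) (mdifferentiable_mul_left_top p⁻¹ _)
    (mdifferentiable_mul_left_top p _) (by simp) v).symm.trans (DFunLike.congr_fun h v)

variable (I) in
/-- The left-invariant vector field with value `v` at the identity. -/
def invField (v : E) (p : G) : TangentSpace I p := fromIdentity p v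

/-- A vector field read in the left-invariant trivialization of the tangent bundle. -/
def coframe (X : (p : G) → TangentSpace I p) (p : G) : E := toIdentity p (X p)

omit [Group G] in
theorem trivializationAt_snd_of_proj_eq [IsManifold I 1 G] (a : G) (z : TangentBundle I G)
    (hz : z.proj = a) : (trivializationAt E (TangentSpace I : G → Type _) a z).2 = z.2 := by
  subst hz
  rw [TangentBundle.trivializationAt_apply]
  exact tangentCoordChange_self (I := I) (x := z.proj) (z := z.proj) (mem_extChartAt_source _)

/-- The differential of the multiplication at (a, b) sends (0, v) to the left translate of v by a.
The map is therefore the tangent map of multiplication composed with the zero section over `f`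
paired with `z`. -/
theorem contMDiff_tangentBundle_mul [LieGroup I ∞ G] {E' H' M : Type*} [NormedAddCommGroup E']
    [NormedSpace ℝ E'] [TopologicalSpace H'] {I' : ModelWithCorners ℝ E' H'} [TopologicalSpace M]
    [ChartedSpace H' M] {f : M → G} {z : M → TangentBundle I G} (hf : ContMDiff I' I ∞ f)
    (hz : ContMDiff I' I.tangent ∞ z) :
    ContMDiff I' I.tangent ∞
      (fun m => (⟨f m * (z m).proj, mfderiv I I (f m * ·) (z m).proj (z m).2⟩ :
        TangentBundle I G)) := by
  let fg : M → TangentBundle I G := fun m => TotalSpace.mk' E (f m) 0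
  have sfg : ContMDiff I' I.tangent ∞ fg :=
    (contMDiff_zeroSection ℝ (TangentSpace I : G → Type _)).comp hf
  let F₂ : (TangentBundle I G × TangentBundle I G) → TangentBundle (I.prod I) (G × G) :=
    (equivTangentBundleProd I G I G).symm
  have S₂ : ContMDiff (I.tangent.prod I.tangent) (I.prod I).tangent ∞ F₂ :=
    contMDiff_equivTangentBundleProd_symm
  let F₃ : TangentBundle (I.prod I) (G × G) → TangentBundle I G :=
    tangentMap (I.prod I) I (fun (p : G × G) => p.1 * p.2)
  have S₃ : ContMDiff (I.prod I).tangent I.tangent ∞ F₃ :=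
    ContMDiff.contMDiff_tangentMap (n := ∞) (m := ∞) (contMDiff_mul I ∞) (by simp)
  have S := (S₃.comp S₂).comp (sfg.prodMk hz)
  convert! S with m
  simp only [Function.comp_apply, tangentMap, F₃, F₂, fg]
  rw [mfderiv_prod_eq_add_apply ((contMDiff_mul I ∞).mdifferentiable (by simp) _)]
  refine ((congrArg₂ (· + ·) (map_zero _) rfl).trans (zero_add (M := E) _)).symm

theorem contMDiff_mk_one [IsManifold I ∞ G] :
    ContMDiff 𝓘(ℝ, E) I.tangent ∞ (fun v : E => (⟨(1 : G), v⟩ : TangentBundle I G)) := by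
  intro v
  rw [contMDiffAt_totalSpace]
  refine ⟨contMDiffAt_const, ?_⟩
  have : (fun x : E => (trivializationAt E (TangentSpace I : G → Type _) (1 : G)
      (⟨(1 : G), x⟩ : TangentBundle I G)).2) = id := by
    ext x
    exact trivializationAt_snd_of_proj_eq _ _ rfl
  exact this ▸ contMDiffAt_id

theorem contMDiff_fromIdentity [LieGroup I ∞ G] :
    ContMDiff (I.prod 𝓘(ℝ, E)) I.tangent ∞
      (fun z : G × E => (⟨z.1, fromIdentity z.1 z.2⟩ : TangentBundle I G)) := by
  have := contMDiff_tangentBundle_mul (I := I) (contMDiff_fst (I := I) (J := 𝓘(ℝ, E)) (n := ∞)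
    (M := G) (N := E)) (contMDiff_mk_one.comp contMDiff_snd)
  convert this using 2 with z
  simp only [Function.comp_apply]
  congr 1
  exact (mul_one _).symm

/-- Left translating a vector z by the inverse of its base point always lands over 1, and over its
own base point a trivialization does nothing to the fibre coordinate. So the vector part, as a map
into the fixed space E, inherits smoothness. -/
theorem contMDiff_toIdentity [LieGroup I ∞ G] :
    ContMDiff I.tangent 𝓘(ℝ, E) ∞
      (fun z : TangentBundle I G => show E from toIdentity z.proj z.2) := by
  have h := contMDiff_tangentBundle_mul (I := I) (f := fun z : TangentBundle I G => z.proj⁻¹)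
    (z := id) ((contMDiff_proj _).inv) contMDiff_id
  intro z
  have h' := (h z)
  rw [contMDiffAt_totalSpace] at h'
  refine h'.2.congr_of_eventuallyEq (Eventually.of_forall fun w => ?_)
  exact (trivializationAt_snd_of_proj_eq (I := I) (z.proj⁻¹ * z.proj)
    (⟨w.proj⁻¹ * w.proj, mfderiv I I (w.proj⁻¹ * ·) w.proj w.2⟩ : TangentBundle I G) (by simp)).symm

theorem isSmoothField_iff [LieGroup I ∞ G] (X : (p : G) → TangentSpace I p) :
    IsSmoothField X ↔ ContMDiff I 𝓘(ℝ, E) ∞ (coframe X) := by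
  refine ⟨fun h => contMDiff_toIdentity.comp h, fun h => ?_⟩
  have := (contMDiff_fromIdentity (I := I) (G := G)).comp (contMDiff_id.prodMk h)
  refine this.congr fun p => ?_
  simp only [Function.comp_apply, coframe, id]
  congr 1
  exact (fromIdentity_toIdentity p (X p)).symm

/-- The pointwise version is needed because tensoriality arguments multiply fields by functions
differentiable only at the point considered. -/
theorem mdifferentiableAt_iff_coframe [LieGroup I ∞ G] (X : (p : G) → TangentSpace I p) (p : G) :
    MDifferentiableAt I I.tangent (fun x => (⟨x, X x⟩ : TangentBundle I G)) p ↔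
      MDifferentiableAt I 𝓘(ℝ, E) (coframe X) p := by
  refine ⟨fun h => ((contMDiff_toIdentity (I := I) (G := G)).mdifferentiable (by simp) _).comp p h,
    fun h => ?_⟩
  have := ((contMDiff_fromIdentity (I := I) (G := G)).mdifferentiable (by simp) _).comp p
    (mdifferentiableAt_id.prodMk h)
  convert this using 2 with q
  simp only [Function.comp_apply, coframe, id]
  congr 1
  exact (fromIdentity_toIdentity q (X q)).symm

theorem coframe_invField [LieGroup I ∞ G] (v : E) :
    coframe (invField I v : (p : G) → TangentSpace I p) = fun _ => v :=
  funext fun p => toIdentity_fromIdentity p v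

theorem isSmoothField_invField [LieGroup I ∞ G] (v : E) :
    IsSmoothField (invField I v : (p : G) → TangentSpace I p) := by
  rw [isSmoothField_iff, coframe_invField]
  exact contMDiff_const

theorem IsSmoothField.mdifferentiableAt [LieGroup I ∞ G] {X : (p : G) → TangentSpace I p}
    (h : IsSmoothField X) (p : G) :
    MDifferentiableAt I I.tangent (fun x => (⟨x, X x⟩ : TangentBundle I G)) p :=
  ContMDiff.mdifferentiable h (by simp) p

theorem IsSmoothField.coframe_mdifferentiableAt [LieGroup I ∞ G] {X : (p : G) → TangentSpace I p}
    (h : IsSmoothField X) (p : G) : MDifferentiableAt I 𝓘(ℝ, E) (coframe X) p :=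
  (mdifferentiableAt_iff_coframe X p).1 (h.mdifferentiableAt p)

theorem lieGroup_minSmoothness [LieGroup I ∞ G] : LieGroup I (minSmoothness ℝ 3) G :=
  LieGroup.of_le (n := ∞) (by
    rw [minSmoothness_of_isRCLikeNormedField]
    exact WithTop.coe_le_coe.2 (le_top (a := (3 : ℕ∞))))

variable (I G) in
/-- The Lie bracket of the Lie algebra of a Lie group, as a bilinear map. -/
def bracketMap [LieGroup I ∞ G] [CompleteSpace E] : E →ₗ[ℝ] E →ₗ[ℝ] E :=
  haveI : LieGroup I (minSmoothness ℝ 3) G := lieGroup_minSmoothness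
  (LinearMap.mk₂ ℝ (fun v w : GroupLieAlgebra I G => ⁅v, w⁆)
    (fun a b c => add_lie (L := GroupLieAlgebra I G) a b c)
    (fun a b c => smul_lie (L := GroupLieAlgebra I G) a b c)
    (fun a b c => lie_add (L := GroupLieAlgebra I G) a b c)
    (fun a b c => lie_smul (L := GroupLieAlgebra I G) a b c) :
    GroupLieAlgebra I G →ₗ[ℝ] GroupLieAlgebra I G →ₗ[ℝ] GroupLieAlgebra I G)

theorem bracketMap_swap [LieGroup I ∞ G] [CompleteSpace E] (v w : E) :
    bracketMap I G v w = -bracketMap I G w v := by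
  have : LieGroup I (minSmoothness ℝ 3) G := lieGroup_minSmoothness
  exact (@lie_skew (GroupLieAlgebra I G) _ v w).symm

theorem mlieBracket_invField [LieGroup I ∞ G] [CompleteSpace E] (v w : E) (p : G) :
    mlieBracket I (invField I v) (invField I w) p = invField I (bracketMap I G v w) p := by
  have : LieGroup I (minSmoothness ℝ 3) G := lieGroup_minSmoothness
  exact (congrFun (mulInvariantVector_mlieBracket (I := I) (G := G) v w) p).symm

theorem coframe_mlieBracket_invField [LieGroup I ∞ G] [CompleteSpace E] (v w : E) (p : G) :
    coframe (mlieBracket I (invField I v) (invField I w)) p = bracketMap I G v w :=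
  (congrArg (toIdentity p) (mlieBracket_invField v w p)).trans (toIdentity_fromIdentity p _)

/-- Both sides obey the same Leibniz rules, so their difference Φ is tensorial in X and Y and
depends only on their values at p. Replacing X and Y by the invariant fields with those values makes
the coframes constant, and the formula reduces to the definition of the algebra bracket. -/
theorem coframe_mlieBracket [LieGroup I ∞ G] [FiniteDimensional ℝ E] [CompleteSpace E]
    {X Y : (p : G) → TangentSpace I p} {p : G}
    (hX : MDifferentiableAt I I.tangent (fun x => (⟨x, X x⟩ : TangentBundle I G)) p)
    (hY : MDifferentiableAt I I.tangent (fun x => (⟨x, Y x⟩ : TangentBundle I G)) p) :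
    coframe (mlieBracket I X Y) p = mvfderiv I (coframe Y) p (X p) - mvfderiv I (coframe X) p (Y p)
      + bracketMap I G (coframe X p) (coframe Y p) := by
  let Φ : ((p : G) → TangentSpace I p) → ((p : G) → TangentSpace I p) → E := fun X Y =>
    coframe (mlieBracket I X Y) p - (mvfderiv I (coframe Y) p (X p)
      - mvfderiv I (coframe X) p (Y p) + bracketMap I G (coframe X p) (coframe Y p))
  have coframe_add : ∀ X Y : (p : G) → TangentSpace I p, coframe (X + Y) = coframe X + coframe Y :=
    fun X Y => funext fun q => map_add (toIdentity q) (X q) (Y q)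
  have coframe_smul : ∀ (f : G → ℝ) (Y : (p : G) → TangentSpace I p),
    coframe (f • Y) = f • coframe Y := fun X Y => funext fun q => map_smul (toIdentity q) (X q) (Y q)
  have hΦ₁ : ∀ τ : (p : G) → TangentSpace I p,
      MDifferentiableAt I I.tangent (fun x => (⟨x, τ x⟩ : TangentBundle I G)) p →
      TensorialAt I E (Φ · τ) p := by
    intro τ hτ
    constructor
    · intro f σ hf hσ
      have hσ' := (mdifferentiableAt_iff_coframe σ p).1 hσ
      have h1 : coframe (mlieBracket I (f • σ) τ) p = - mvfderiv I f p (τ p) • coframe σ p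
          + f p • coframe (mlieBracket I σ τ) p := by
        have := congrArg (toIdentity p) (mlieBracket_smul_left (W := τ) hf hσ)
        rw [map_add, map_smul, map_smul] at this
        exact this
      have h2 : mvfderiv I (f • coframe σ) p (τ p) =
          f p • mvfderiv I (coframe σ) p (τ p) + mvfderiv I f p (τ p) • coframe σ p := by
        rw [mvfderiv_smul hf hσ']; rfl
      have h3 : mvfderiv I (coframe τ) p ((f • σ) p) = f p • mvfderiv I (coframe τ) p (σ p) :=
        map_smul _ _ _
      have h4 : bracketMap I G ((f • coframe σ) p) (coframe τ p) =
          f p • bracketMap I G (coframe σ p) (coframe τ p) := by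
        rw [Pi.smul_apply', map_smul]; rfl
      simp only [Φ, coframe_smul, h1, h2, h3, h4]
      module
    · intro σ σ' h h'
      have hσ := (mdifferentiableAt_iff_coframe σ p).1 h
      have hσ' := (mdifferentiableAt_iff_coframe σ' p).1 h'
      have h1 : coframe (mlieBracket I (σ + σ') τ) p = coframe (mlieBracket I σ τ) p
          + coframe (mlieBracket I σ' τ) p := by
        have := congrArg (toIdentity p) (mlieBracket_add_left (W := τ) h h')
        rw [map_add] at this
        exact this
      have h2 : mvfderiv I (coframe σ + coframe σ') p (τ p) =
          mvfderiv I (coframe σ) p (τ p) + mvfderiv I (coframe σ') p (τ p) := by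
        rw [mvfderiv_add hσ hσ']; rfl
      have h3 : mvfderiv I (coframe τ) p ((σ + σ') p) =
          mvfderiv I (coframe τ) p (σ p) + mvfderiv I (coframe τ) p (σ' p) :=
        map_add _ _ _
      have h4 : bracketMap I G ((coframe σ + coframe σ') p) (coframe τ p) =
          bracketMap I G (coframe σ p) (coframe τ p)
            + bracketMap I G (coframe σ' p) (coframe τ p) := by
        rw [Pi.add_apply, map_add]; rfl
      simp only [Φ, coframe_add, h1, h2, h3, h4]
      module
  -- Antisymmetry transfers tensoriality from the first argument to the second.
  have hswap : ∀ σ τ, Φ σ τ = -Φ τ σ := by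
    intro σ τ
    have h1 : coframe (mlieBracket I σ τ) p = -coframe (mlieBracket I τ σ) p := by
      have := congrArg (toIdentity p) (mlieBracket_swap_apply (I := I) (V := σ) (W := τ) (x := p))
      rw [map_neg] at this
      exact this
    simp only [Φ, h1, bracketMap_swap (coframe σ p)]
    module
  have hΦ₂ : ∀ σ : (p : G) → TangentSpace I p,
      MDifferentiableAt I I.tangent (fun x => (⟨x, σ x⟩ : TangentBundle I G)) p →
      TensorialAt I E (Φ σ ·) p := by
    intro σ hσ
    constructor
    · intro f τ hf hτ
      simp only [hswap σ, (hΦ₁ σ hσ).smul hf hτ, smul_neg]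
    · intro τ τ' h h'
      simp only [hswap σ, (hΦ₁ σ hσ).add h h', neg_add]
  have key : Φ X Y = Φ (invField I (coframe X p)) (invField I (coframe Y p)) :=
    TensorialAt.pointwise₂ hΦ₁ hΦ₂ hX ((isSmoothField_invField _).mdifferentiableAt p) hY
      ((isSmoothField_invField _).mdifferentiableAt p) (fromIdentity_toIdentity p (X p)).symm
      (fromIdentity_toIdentity p (Y p)).symm
  have hzero : Φ (invField I (coframe X p)) (invField I (coframe Y p)) = 0 := by
    simp only [Φ, coframe_invField, mvfderiv_const]
    have : coframe (mlieBracket I (invField I (coframe X p)) (invField I (coframe Y p))) p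
        = bracketMap I G (coframe X p) (coframe Y p) := by
      exact coframe_mlieBracket_invField _ _ p
    rw [this]
    simp
  exact sub_eq_zero.1 (key.trans hzero)

end LieGroupCalculus
end HKT

namespace HKT
open VectorField Bundle Filter Topology Set

/-! ### Vector fields as derivations, and brackets of related fields. -/

section Derivation

variable {E : Type*} [NormedAddCommGroup E] [NormedSpace ℝ E] [CompleteSpace E]
  {H : Type*} [TopologicalSpace H] {I : ModelWithCorners ℝ E H}
  {M : Type*} [TopologicalSpace M] [ChartedSpace H M] [IsManifold I ∞ M]
  {F : Type*} [NormedAddCommGroup F] [NormedSpace ℝ F]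

-- The pulled-back field is the image of W under the inverse of the differential of the inverse
-- chart; the chain rule makes that differential and its inverse cancel.
omit [CompleteSpace E] in
theorem fderivWithin_chart_mpullback {f : M → F} {x : M} {z : E} (hz : z ∈ (extChartAt I x).target)
    (hf : MDifferentiableAt I 𝓘(ℝ, F) f ((extChartAt I x).symm z)) (W : (y : M) → TangentSpace I y) :
    fderivWithin ℝ (f ∘ (extChartAt I x).symm) (range I) z
      (mpullbackWithin 𝓘(ℝ, E) I (extChartAt I x).symm W (range I) z) =
    mvfderiv I f ((extChartAt I x).symm z) (W ((extChartAt I x).symm z)) := by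
  have hz' : z ∈ range I := extChartAt_target_subset_range x hz
  have hu : UniqueMDiffWithinAt 𝓘(ℝ, E) (range I) z := (I.uniqueMDiffOn) z hz'
  have hinv := isInvertible_mfderivWithin_extChartAt_symm (I := I) hz
  have h := mfderiv_comp_mfderivWithin (I' := I) z hf (mdifferentiableWithinAt_extChartAt_symm hz) hu
  rw [mfderivWithin_eq_fderivWithin] at h
  rw [h]
  have : (mfderivWithin 𝓘(ℝ, E) I (extChartAt I x).symm (range I) z)
      ((mfderivWithin 𝓘(ℝ, E) I (extChartAt I x).symm (range I) z).inverse
        (W ((extChartAt I x).symm z))) = W ((extChartAt I x).symm z) :=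
    hinv.self_apply_inverse _
  exact congrArg (mfderiv I 𝓘(ℝ, F) f ((extChartAt I x).symm z)) this

theorem differentiableWithinAt_mpullbackWithin_chart {x : M} {U : (y : M) → TangentSpace I y}
    (hU : MDifferentiableAt I I.tangent (fun x => (⟨x, U x⟩ : TangentBundle I M)) x) :
    DifferentiableWithinAt ℝ (mpullbackWithin 𝓘(ℝ, E) I (extChartAt I x).symm U (range I)) (range I)
      (extChartAt I x x) := by
  have := MDifferentiableWithinAt.differentiableWithinAt_mpullbackWithin_vectorField
    (s := univ) hU.mdifferentiableWithinAt
  rwa [preimage_univ, univ_inter] at this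

omit [CompleteSpace E] in
theorem mvfderiv_comp_chart_eventuallyEq {f : M → F} {x : M} (hf : ContMDiffAt I 𝓘(ℝ, F) 2 f x)
    (U : (y : M) → TangentSpace I y) :
    ((fun y => mvfderiv I f y (U y)) ∘ (extChartAt I x).symm) =ᶠ[𝓝[range I] (extChartAt I x x)]
      (fun z => fderivWithin ℝ (f ∘ (extChartAt I x).symm) (range I) z
        (mpullbackWithin 𝓘(ℝ, E) I (extChartAt I x).symm U (range I) z)) := by
  have hnear : ∀ᶠ y in 𝓝 x, MDifferentiableAt I 𝓘(ℝ, F) f y :=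
    ((contMDiffAt_iff_contMDiffAt_nhds (by simp)).1 hf).mono fun y hy => hy.mdifferentiableAt (by simp)
  have hnear' : ∀ᶠ z in 𝓝[range I] (extChartAt I x x),
      MDifferentiableAt I 𝓘(ℝ, F) f ((extChartAt I x).symm z) := by
    have : Tendsto (extChartAt I x).symm (𝓝[range I] (extChartAt I x x)) (𝓝 x) := by
      have := (contMDiffWithinAt_extChartAt_symm_range (I := I) (n := 0) x
        (mem_extChartAt_target x)).continuousWithinAt
      rw [ContinuousWithinAt, extChartAt_to_inv x] at this
      exact this
    exact this.eventually hnear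
  filter_upwards [hnear', extChartAt_target_mem_nhdsWithin (I := I) x] with z hz hz'
  exact (fderivWithin_chart_mpullback hz' hz U).symm

/-- In a chart the function is the C¹ derivative of a C² function, applied to a field that is
differentiable at the point. -/
theorem mdifferentiableAt_mvfderiv_apply {f : M → F} {x : M} (hf : ContMDiffAt I 𝓘(ℝ, F) 2 f x)
    {U : (y : M) → TangentSpace I y}
    (hU : MDifferentiableAt I I.tangent (fun x => (⟨x, U x⟩ : TangentBundle I M)) x) :
    MDifferentiableAt I 𝓘(ℝ, F) (fun y => mvfderiv I f y (U y)) x := by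
  set φ := extChartAt I x with hφ
  have hxr : φ x ∈ range I := extChartAt_target_subset_range x (mem_extChartAt_target x)
  have hcd : ContDiffWithinAt ℝ 2 (f ∘ φ.symm) (range I) (φ x) := (contMDiffAt_iff.1 hf).2
  have h1 : DifferentiableWithinAt ℝ (fun z => fderivWithin ℝ (f ∘ φ.symm) (range I) z
      (mpullbackWithin 𝓘(ℝ, E) I φ.symm U (range I) z)) (range I) (φ x) :=
    ((hcd.fderivWithin_right I.uniqueDiffOn (m := 1) (by norm_num) hxr).differentiableWithinAt
      one_ne_zero).clm_apply (differentiableWithinAt_mpullbackWithin_chart hU)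
  have heq := mvfderiv_comp_chart_eventuallyEq hf U
  have h2 := (h1.congr_of_eventuallyEq heq (heq.self_of_nhdsWithin hxr)).mdifferentiableWithinAt
  have h3 : MDifferentiableAt I 𝓘(ℝ, F) (((fun y => mvfderiv I f y (U y)) ∘ φ.symm) ∘ φ) x := by
    rw [← mdifferentiableWithinAt_univ]
    exact h2.comp x (mdifferentiableAt_extChartAt (mem_chart_source H x)).mdifferentiableWithinAt
      (fun y _ => ⟨_, rfl⟩)
  refine h3.congr_of_eventuallyEq ?_
  filter_upwards [extChartAt_source_mem_nhds (I := I) x] with y hy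
  simp only [Function.comp_apply]
  rw [φ.left_inv hy]

/-- The derivation along a Lie bracket is the commutator of the derivations. -/
theorem mvfderiv_mlieBracket {f : M → F} {x : M} (hf : ContMDiffAt I 𝓘(ℝ, F) 2 f x)
    {V W : (y : M) → TangentSpace I y}
    (hV : MDifferentiableAt I I.tangent (fun x => (⟨x, V x⟩ : TangentBundle I M)) x)
    (hW : MDifferentiableAt I I.tangent (fun x => (⟨x, W x⟩ : TangentBundle I M)) x) :
    mvfderiv I f x (mlieBracket I V W x) =
      mvfderiv I (fun y => mvfderiv I f y (W y)) x (V x)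
        - mvfderiv I (fun y => mvfderiv I f y (V y)) x (W x) := by
  set φ := extChartAt I x with hφ
  have hx : φ x ∈ φ.target := mem_extChartAt_target x
  have hxr : φ x ∈ range I := extChartAt_target_subset_range x hx
  have hxx : φ.symm (φ x) = x := extChartAt_to_inv x
  have hcd : ContDiffWithinAt ℝ 2 (f ∘ φ.symm) (range I) (φ x) := (contMDiffAt_iff.1 hf).2
  -- The vector-space identity in the chart, which rests on symmetry of the second derivative.
  have key := fderivWithin_apply_lieBracket (f := f ∘ φ.symm) (s := range I) (x := φ x) (n := 2) hcd
    (by rw [minSmoothness_of_isRCLikeNormedField]) I.uniqueDiffOn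
    (I.range_subset_closure_interior hxr) hxr (differentiableWithinAt_mpullbackWithin_chart hW)
    (differentiableWithinAt_mpullbackWithin_chart hV)
  have hderiv : ∀ U U' : (y : M) → TangentSpace I y,
      MDifferentiableAt I I.tangent (fun x => (⟨x, U x⟩ : TangentBundle I M)) x →
      fderivWithin ℝ (fun z => fderivWithin ℝ (f ∘ φ.symm) (range I) z
          (mpullbackWithin 𝓘(ℝ, E) I φ.symm U (range I) z)) (range I) (φ x)
        (mpullbackWithin 𝓘(ℝ, E) I φ.symm U' (range I) (φ x)) =
      mvfderiv I (fun y => mvfderiv I f y (U y)) x (U' x) := by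
    intro U U' hU
    have heq := mvfderiv_comp_chart_eventuallyEq hf U
    rw [← heq.fderivWithin_eq (heq.self_of_nhdsWithin hxr)]
    have := fderivWithin_chart_mpullback (f := fun y => mvfderiv I f y (U y)) hx
      (by rw [hxx]; exact mdifferentiableAt_mvfderiv_apply hf hU) U'
    rw [← hφ, hxx] at this
    exact this
  rw [hderiv V W hV, hderiv W V hW] at key
  rw [← key, (hf.mdifferentiableAt (by simp)).mvfderiv]
  -- The tangent space at x is identified with E through the preferred chart at x, so the
  -- differential of that chart at x is the identity and the bracket is literally the chart bracket.
  have : mlieBracket I V W x = lieBracketWithin ℝ (mpullbackWithin 𝓘(ℝ, E) I φ.symm V (range I))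
      (mpullbackWithin 𝓘(ℝ, E) I φ.symm W (range I)) (range I) (φ x) := by
    rw [← mlieBracketWithin_univ, mlieBracketWithin_apply, mfderiv_extChartAt_self, preimage_univ,
      univ_inter]
    exact DFunLike.congr_fun (ContinuousLinearMap.inverse_id (R := ℝ) (M := E)) _
  rw [this]
  rfl

/-- Brackets of related vector fields are related. -/
theorem mfderiv_mlieBracket_of_related {E' H' M' : Type*} [NormedAddCommGroup E']
    [NormedSpace ℝ E'] [CompleteSpace E'] [TopologicalSpace H'] {I' : ModelWithCorners ℝ E' H'}
    [TopologicalSpace M'] [ChartedSpace H' M'] [IsManifold I' ∞ M'] {f : M → M'}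
    (hf : ContMDiff I I' ∞ f) {V W : (y : M) → TangentSpace I y}
    {V' W' : (y : M') → TangentSpace I' y} {x : M}
    (hV : MDifferentiableAt I I.tangent (fun x => (⟨x, V x⟩ : TangentBundle I M)) x)
    (hW : MDifferentiableAt I I.tangent (fun x => (⟨x, W x⟩ : TangentBundle I M)) x)
    (hV' : MDifferentiableAt I' I'.tangent (fun x => (⟨x, V' x⟩ : TangentBundle I' M')) (f x))
    (hW' : MDifferentiableAt I' I'.tangent (fun x => (⟨x, W' x⟩ : TangentBundle I' M')) (f x))
    (hVV' : ∀ y, mfderiv I I' f y (V y) = V' (f y)) (hWW' : ∀ y, mfderiv I I' f y (W y) = W' (f y)) :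
    mfderiv I I' f x (mlieBracket I V W x) = mlieBracket I' V' W' (f x) := by
  have hmf : MDifferentiable I I' f := hf.mdifferentiable (by simp)
  -- The vector-valued chart is a single test function that suffices: its differential at f x is the
  -- identity, so two vectors there agree once h has equal derivatives along them. No invertibility
  -- of the differential of f is used, which allows f to be a projection.
  set h := extChartAt I' (f x) with hh
  have hh2 : ContMDiffAt I' 𝓘(ℝ, E') 2 h (f x) := contMDiffAt_extChartAt
  have hh2' : ContMDiffAt I 𝓘(ℝ, E') 2 (h ∘ f) x :=
    hh2.comp x ((hf x).of_le (WithTop.coe_le_coe.2 (le_top (a := (2 : ℕ∞)))))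
  have hnear : ∀ᶠ y in 𝓝 x, MDifferentiableAt I' 𝓘(ℝ, E') h (f y) :=
    hf.continuous.continuousAt.eventually (((contMDiffAt_iff_contMDiffAt_nhds (by simp)).1 hh2).mono
      fun y hy => hy.mdifferentiableAt (by simp))
  have hcomm : ∀ (U : (y : M) → TangentSpace I y) (U' : (y : M') → TangentSpace I' y),
      (∀ y, mfderiv I I' f y (U y) = U' (f y)) →
      (fun y => mvfderiv I (h ∘ f) y (U y)) =ᶠ[𝓝 x] (fun y => mvfderiv I' h y (U' y)) ∘ f := by
    intro U U' hUU'
    filter_upwards [hnear] with y hy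
    rw [Function.comp_apply, ← hUU' y]
    exact mfderiv_comp_apply y hy (hmf y) (U y)
  have hder : ∀ (U : (y : M) → TangentSpace I y) (U' : (y : M') → TangentSpace I' y)
      (v : TangentSpace I x),
      MDifferentiableAt I' I'.tangent (fun x => (⟨x, U' x⟩ : TangentBundle I' M')) (f x) →
      (∀ y, mfderiv I I' f y (U y) = U' (f y)) →
      mvfderiv I (fun y => mvfderiv I (h ∘ f) y (U y)) x v =
        mvfderiv I' (fun y => mvfderiv I' h y (U' y)) (f x) (mfderiv I I' f x v) := by
    intro U U' v hU' hUU'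
    have h1 : mvfderiv I (fun y => mvfderiv I (h ∘ f) y (U y)) x =
        mvfderiv I ((fun y => mvfderiv I' h y (U' y)) ∘ f) x := by
      ext w
      exact DFunLike.congr_fun ((hcomm U U' hUU').mfderiv_eq) w
    rw [h1]
    exact mfderiv_comp_apply x (mdifferentiableAt_mvfderiv_apply hh2 hU') (hmf x) v
  have key := mvfderiv_mlieBracket hh2' hV hW
  rw [hder W W' _ hW' hWW', hder V V' _ hV' hVV', hVV', hWW',
    ← mvfderiv_mlieBracket hh2 hV' hW'] at key
  have h2 : mvfderiv I (h ∘ f) x (mlieBracket I V W x) =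
      mvfderiv I' h (f x) (mfderiv I I' f x (mlieBracket I V W x)) :=
    mfderiv_comp_apply x hnear.self_of_nhds (hmf x) _
  rw [h2] at key
  have h3 : ∀ v : TangentSpace I' (f x), mvfderiv I' h (f x) v = v := fun v =>
    DFunLike.congr_fun (mfderiv_extChartAt_self (I := I') (x := f x)) v
  rwa [h3, h3] at key

end Derivation
end HKT

namespace HKT
open VectorField Filter Topology

/-! ### The Lie bracket of the semidirect product. -/

section SemidirectBracket

variable {E : Type*} [NormedAddCommGroup E] [NormedSpace ℝ E]
  {H : Type*} [TopologicalSpace H] {I : ModelWithCorners ℝ E H}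
  {G : Type*} [TopologicalSpace G] [ChartedSpace H G] [Group G] {q : ℕ}

/-- The representation as a map into the real endomorphisms of `ℍ^q`. -/
def QuaternionicRep.realRep (π : QuaternionicRep I G q) (a : G) : HSpace q →L[ℝ] HSpace q :=
  realMap (π.toHom a).val

/-- The differential at the identity of a quaternionic representation. -/
def QuaternionicRep.deriv (π : QuaternionicRep I G q) : E →L[ℝ] HSpace q →L[ℝ] HSpace q :=
  mvfderiv I π.realRep (1 : G)

theorem QuaternionicRep.mdifferentiable_realRep (π : QuaternionicRep I G q) :
    MDifferentiable I 𝓘(ℝ, HSpace q →L[ℝ] HSpace q) π.realRep :=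
  π.smooth.mdifferentiable (by simp)

theorem QuaternionicRep.realRep_mul (π : QuaternionicRep I G q) (a b : G) :
    π.realRep (a * b) = (π.realRep a).comp (π.realRep b) := by
  ext v : 1
  change (π.toHom (a * b)).val v = (π.toHom a).val ((π.toHom b).val v)
  rw [map_mul]
  rfl

theorem QuaternionicRep.realRep_one (π : QuaternionicRep I G q) :
    π.realRep 1 = ContinuousLinearMap.id ℝ _ := by
  ext v : 1
  change (π.toHom 1).val v = v
  rw [map_one]
  rfl

theorem QuaternionicRep.realRep_leftMul (π : QuaternionicRep I G q) (g : G) (a : ℍ[ℝ])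
    (v : HSpace q) : π.realRep g (leftMul q a v) = leftMul q a (π.realRep g v) :=
  map_smul (π.toHom g).val a v

theorem mvfderiv_apply_const {M : Type*} [TopologicalSpace M] [ChartedSpace H M]
    {F F' : Type*} [NormedAddCommGroup F] [NormedSpace ℝ F] [NormedAddCommGroup F']
    [NormedSpace ℝ F'] {f : M → F} {x : M} (hf : MDifferentiableAt I 𝓘(ℝ, F) f x) (L : F →L[ℝ] F')
    (v : TangentSpace I x) :
    mvfderiv I (fun y => L (f y)) x v = L (mvfderiv I f x v) := by
  have := mfderiv_comp_apply (I' := 𝓘(ℝ, F)) (I'' := 𝓘(ℝ, F')) x L.mdifferentiableAt hf v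
  rw [ContinuousLinearMap.mfderiv_eq] at this
  exact this

theorem QuaternionicRep.deriv_leftMul (π : QuaternionicRep I G q) (x : E) (a : ℍ[ℝ])
    (v : HSpace q) : π.deriv x (leftMul q a v) = leftMul q a (π.deriv x v) := by
  have h1 := mvfderiv_apply_const (I := I) (π.mdifferentiable_realRep (1 : G))
    (ContinuousLinearMap.apply ℝ _ (leftMul q a v)) x
  have h2 := mvfderiv_apply_const (I := I) (π.mdifferentiable_realRep (1 : G))
    ((leftMul q a).comp (ContinuousLinearMap.apply ℝ _ v)) x
  have h3 : (fun y => (ContinuousLinearMap.apply ℝ (HSpace q) (leftMul q a v)) (π.realRep y)) =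
      fun y => ((leftMul q a).comp (ContinuousLinearMap.apply ℝ _ v)) (π.realRep y) :=
    funext fun y => π.realRep_leftMul y a v
  rw [h3] at h1
  exact h1.symm.trans h2

/-- Left translation by (a, v) is the product of left translation by a and the affine map w ↦ v +
π(a)w, so its differential is block diagonal. -/
theorem TGroup.fromIdentity_eq [LieGroup I ∞ G] (π : QuaternionicRep I G q) (p : TGroup π)
    (z : E × HSpace q) :
    (fromIdentity (I := I.prod 𝓘(ℝ, HSpace q)) p z : E × HSpace q) =
      ((fromIdentity (I := I) p.1 z.1 : E), π.realRep p.1 z.2) := by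
  have h1 : MDifferentiableAt I I (p.1 * ·) (1 : G) := mdifferentiable_mul_left_top _ _
  have h2 : HasMFDerivAt 𝓘(ℝ, HSpace q) 𝓘(ℝ, HSpace q) (fun w => p.2 + π.realRep p.1 w) 0
      (π.realRep p.1) := by
    have := ((π.realRep p.1).hasFDerivAt (x := 0)).const_add p.2
    exact this.hasMFDerivAt
  have h := (h1.hasMFDerivAt.prodMap (p := ((1 : G), (0 : HSpace q))) h2).mfderiv
  refine (DFunLike.congr_fun h z).trans (Prod.ext rfl ?_)
  exact DFunLike.congr_fun h2.mfderiv z.2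

theorem TGroup.invField_eq [LieGroup I ∞ G] (π : QuaternionicRep I G q) (p : TGroup π)
    (z : E × HSpace q) :
    (invField (I.prod 𝓘(ℝ, HSpace q)) z p : E × HSpace q) =
      ((invField I z.1 p.1 : E), π.realRep p.1 z.2) :=
  TGroup.fromIdentity_eq π p z

/-- The projection `G ⋉ ℍ^q → G`. -/
def TGroup.fst (π : QuaternionicRep I G q) (p : TGroup π) : G := p.1

/-- The projection `G ⋉ ℍ^q → ℍ^q`. -/
def TGroup.snd (π : QuaternionicRep I G q) (p : TGroup π) : HSpace q := p.2

theorem TGroup.contMDiff_fst (π : QuaternionicRep I G q) :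
    ContMDiff (I.prod 𝓘(ℝ, HSpace q)) I ∞ (TGroup.fst π) :=
  _root_.contMDiff_fst (I := I) (J := 𝓘(ℝ, HSpace q)) (M := G) (N := HSpace q)

theorem TGroup.contMDiff_snd (π : QuaternionicRep I G q) {n : ℕ∞ω} :
    ContMDiff (I.prod 𝓘(ℝ, HSpace q)) 𝓘(ℝ, HSpace q) n (TGroup.snd π) :=
  _root_.contMDiff_snd (I := I) (J := 𝓘(ℝ, HSpace q)) (M := G) (N := HSpace q)

theorem TGroup.mfderiv_fst (π : QuaternionicRep I G q) (p : TGroup π) (z : E × HSpace q) :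
    mfderiv (I.prod 𝓘(ℝ, HSpace q)) I (TGroup.fst π) p z = z.1 :=
  DFunLike.congr_fun (_root_.mfderiv_fst (I := I) (I' := 𝓘(ℝ, HSpace q)) (M := G)
    (M' := HSpace q) (x := p)) z

theorem TGroup.mvfderiv_snd (π : QuaternionicRep I G q) (p : TGroup π) (z : E × HSpace q) :
    mvfderiv (I.prod 𝓘(ℝ, HSpace q)) (TGroup.snd π) p z = z.2 :=
  DFunLike.congr_fun (_root_.mfderiv_snd (I := I) (I' := 𝓘(ℝ, HSpace q)) (M := G)
    (M' := HSpace q) (x := p)) z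

theorem TGroup.mfderiv_fst_invField [LieGroup I ∞ G] (π : QuaternionicRep I G q) (p : TGroup π)
    (z : E × HSpace q) :
    mfderiv (I.prod 𝓘(ℝ, HSpace q)) I (TGroup.fst π) p (invField (I.prod 𝓘(ℝ, HSpace q)) z p) =
      invField I z.1 (TGroup.fst π p) :=
  (TGroup.mfderiv_fst π p _).trans (congrArg Prod.fst (TGroup.invField_eq π p z))

theorem TGroup.mvfderiv_snd_invField [LieGroup I ∞ G] (π : QuaternionicRep I G q) (p : TGroup π)
    (z : E × HSpace q) :
    mvfderiv (I.prod 𝓘(ℝ, HSpace q)) (TGroup.snd π) p (invField (I.prod 𝓘(ℝ, HSpace q)) z p) =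
      π.realRep (TGroup.fst π p) z.2 :=
  (TGroup.mvfderiv_snd π p _).trans (congrArg Prod.snd (TGroup.invField_eq π p z))

theorem TGroup.mvfderiv_realRep [LieGroup I ∞ G] (π : QuaternionicRep I G q) (w : HSpace q)
    (z : E × HSpace q) :
    mvfderiv (I.prod 𝓘(ℝ, HSpace q)) (fun y => π.realRep (TGroup.fst π y) w) 1
      (invField (I.prod 𝓘(ℝ, HSpace q)) z 1) = π.deriv z.1 w := by
  have h1 : MDifferentiableAt I 𝓘(ℝ, HSpace q) (fun a => π.realRep a w) (1 : G) :=
    ((ContinuousLinearMap.apply ℝ _ w).mdifferentiableAt).comp (1 : G)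
      (π.mdifferentiable_realRep (1 : G))
  have h2 := mfderiv_comp_apply (I' := I) (g := fun a => π.realRep a w) (1 : TGroup π) h1
    ((TGroup.contMDiff_fst π).mdifferentiable (by simp) 1)
    (invField (I.prod 𝓘(ℝ, HSpace q)) z 1)
  rw [TGroup.mfderiv_fst_invField] at h2
  refine h2.trans ?_
  have h3 : invField I z.1 (1 : G) = z.1 := by
    have : (fun x : G => 1 * x) = id := funext one_mul
    change mfderiv I I (fun x : G => 1 * x) 1 z.1 = z.1
    rw [this, mfderiv_id]
    rfl
  have h4 := mvfderiv_apply_const (I := I) (π.mdifferentiable_realRep (1 : G))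
    (ContinuousLinearMap.apply ℝ _ w) (invField I z.1 (1 : G))
  rw [h3] at h4
  exact (congrArg (mvfderiv I (fun a => π.realRep a w) (1 : G)) h3).trans h4

theorem bracketMap_apply [LieGroup I ∞ G] [CompleteSpace E] (v w : E) :
    bracketMap I G v w = mlieBracket I (invField I v) (invField I w) (1 : G) := rfl

/-- Invariant fields are related under the projection to G, which gives the first component. For the
second, the ℍ^q-valued projection has derivative p ↦ π(p.1)w along the invariant field of (x, w);
differentiating once more at the identity and taking the commutator gives the two terms in dπ. -/
theorem TGroup.bracketMap_eq [LieGroup I ∞ G] [CompleteSpace E] (π : QuaternionicRep I G q)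
    (z z' : E × HSpace q) :
    bracketMap (I.prod 𝓘(ℝ, HSpace q)) (TGroup π) z z' =
      (bracketMap I G z.1 z'.1, π.deriv z.1 z'.2 - π.deriv z'.1 z.2) := by
  have hsm : ∀ z : E × HSpace q, MDifferentiableAt (I.prod 𝓘(ℝ, HSpace q))
      (I.prod 𝓘(ℝ, HSpace q)).tangent (fun x => (⟨x, invField (I.prod 𝓘(ℝ, HSpace q)) z x⟩ :
        TangentBundle (I.prod 𝓘(ℝ, HSpace q)) (TGroup π))) (1 : TGroup π) :=
    fun z => (isSmoothField_invField z).mdifferentiableAt _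
  rw [bracketMap_apply]
  refine Prod.ext ?_ ?_
  · exact (TGroup.mfderiv_fst π 1 _).symm.trans
      (mfderiv_mlieBracket_of_related (TGroup.contMDiff_fst π) (hsm z) (hsm z')
      ((isSmoothField_invField _).mdifferentiableAt _)
      ((isSmoothField_invField _).mdifferentiableAt _)
      (TGroup.mfderiv_fst_invField π · z) (TGroup.mfderiv_fst_invField π · z'))
  · have := mvfderiv_mlieBracket (x := 1) (TGroup.contMDiff_snd π).contMDiffAt (hsm z) (hsm z')
    simp only [TGroup.mvfderiv_snd_invField, TGroup.mvfderiv_realRep] at this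
    exact (TGroup.mvfderiv_snd π 1 _).symm.trans this

end SemidirectBracket
end HKT

namespace HKT
open VectorField Filter Topology

/-! ### Functions with zero differential. -/

section Constancy

variable {E : Type*} [NormedAddCommGroup E] [NormedSpace ℝ E]
  {H : Type*} [TopologicalSpace H] {I : ModelWithCorners ℝ E H}
  {M : Type*} [TopologicalSpace M] [ChartedSpace H M]
  {F : Type*} [NormedAddCommGroup F] [NormedSpace ℝ F]

/-- Without boundary the chart target is open and contains a ball around the image of x. The chart
expression has zero derivative there, so convexity makes it constant. -/
theorem isLocallyConstant_of_mvfderiv_eq_zero [I.Boundaryless] [IsManifold I ∞ M] {f : M → F}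
    (hf : MDifferentiable I 𝓘(ℝ, F) f) (h0 : ∀ x, mvfderiv I f x = 0) : IsLocallyConstant f := by
  rw [IsLocallyConstant.iff_eventually_eq]
  intro x
  have hopen : IsOpen (extChartAt I x).target := isOpen_extChartAt_target x
  obtain ⟨r, hr, hball⟩ := Metric.isOpen_iff.1 hopen _ (mem_extChartAt_target x)
  have hsymm : ∀ z ∈ (extChartAt I x).target,
      MDifferentiableAt 𝓘(ℝ, E) I (extChartAt I x).symm z := fun z hz => by
    have := mdifferentiableWithinAt_extChartAt_symm hz
    rwa [I.range_eq_univ, mdifferentiableWithinAt_univ] at this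
  have hd : ∀ z ∈ (extChartAt I x).target,
      HasFDerivAt (f ∘ (extChartAt I x).symm) (0 : E →L[ℝ] F) z := fun z hz => by
    have h1 : MDifferentiableAt 𝓘(ℝ, E) 𝓘(ℝ, F) (f ∘ (extChartAt I x).symm) z :=
      (hf _).comp z (hsymm z hz)
    have h2 := mfderiv_comp (I' := I) z (hf _) (hsymm z hz)
    have h3 : mfderiv I 𝓘(ℝ, F) f ((extChartAt I x).symm z) = 0 := h0 _
    rw [h3, mfderiv_eq_fderiv] at h2
    have h4 : fderiv ℝ (f ∘ (extChartAt I x).symm) z = 0 :=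
      h2.trans (ContinuousLinearMap.zero_comp _)
    rw [← h4]
    exact (mdifferentiableAt_iff_differentiableAt.1 h1).hasFDerivAt
  have hconst : ∀ z ∈ Metric.ball (extChartAt I x x) r,
      (f ∘ (extChartAt I x).symm) z = (f ∘ (extChartAt I x).symm) (extChartAt I x x) := fun z hz =>
    (convex_ball _ r).is_const_of_fderivWithin_eq_zero (𝕜 := ℝ)
      (fun y hy => (hd y (hball hy)).differentiableAt.differentiableWithinAt)
      (fun y hy => by
        rw [fderivWithin_of_isOpen Metric.isOpen_ball hy, (hd y (hball hy)).fderiv])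
      hz (Metric.mem_ball_self hr)
  filter_upwards [extChartAt_source_mem_nhds (I := I) x,
    (continuousAt_extChartAt (I := I) x).preimage_mem_nhds (Metric.ball_mem_nhds _ hr)] with y hy hy'
  have := hconst _ hy'
  simp only [Function.comp_apply] at this
  rwa [(extChartAt I x).left_inv hy, extChartAt_to_inv] at this

end Constancy

/-! ### The group Sp(q) in terms of the real inner product. -/

section Symplectic

variable {q : ℕ}

theorem inner_eq_re_hermForm (v w : HSpace q) : inner ℝ v w = (hermForm v w).re := by
  rw [PiLp.inner_apply, hermForm]
  simp only [Quaternion.inner_def]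
  exact (map_sum (AddMonoidHom.mk' (fun a : ℍ[ℝ] => a.re) (fun _ _ => rfl))
    (fun i => v i * star (w i)) Finset.univ).symm

theorem hermForm_smul_left (a : ℍ[ℝ]) (v w : HSpace q) :
    hermForm (a • v) w = a * hermForm v w := by
  simp only [hermForm, PiLp.smul_apply, smul_eq_mul, Finset.mul_sum, mul_assoc]

/-- The real inner product is the real part of the quaternionic form. Since A commutes with left
multiplication, preserving real parts for all av preserves the whole form. -/
theorem mem_Sp_iff (A : GLH q) :
    A ∈ Sp q ↔ ∀ v w : HSpace q, inner ℝ (A.val v) (A.val w) = inner ℝ v w := by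
  constructor
  · intro h v w
    rw [inner_eq_re_hermForm, inner_eq_re_hermForm, h v w]
  · intro h v w
    have key : ∀ a : ℍ[ℝ], (a * (hermForm (A.val v) (A.val w) - hermForm v w)).re = 0 := by
      intro a
      have := h (a • v) w
      rw [map_smul, inner_eq_re_hermForm, inner_eq_re_hermForm, hermForm_smul_left,
        hermForm_smul_left] at this
      rw [mul_sub, Quaternion.re_sub, this, sub_self]
    -- Multiplying the defect by its own conjugate makes the real part its squared norm.
    have h1 := key (star (hermForm (A.val v) (A.val w) - hermForm v w))
    rw [Quaternion.star_mul_self, Quaternion.re_coe] at h1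
    exact sub_eq_zero.1 (Quaternion.normSq_eq_zero.1 h1)

theorem inner_smul_smul_quaternion (a : ℍ[ℝ]) (v w : HSpace q) :
    inner ℝ (a • v) (a • w) = Quaternion.normSq a * inner ℝ v w := by
  simp only [PiLp.inner_apply, Quaternion.inner_def, PiLp.smul_apply, smul_eq_mul, Finset.mul_sum]
  refine Finset.sum_congr rfl fun i _ => ?_
  simp only [Quaternion.re_mul, Quaternion.imI_mul, Quaternion.imJ_mul, Quaternion.imK_mul,
    Quaternion.re_star, Quaternion.imI_star, Quaternion.imJ_star, Quaternion.imK_star,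
    Quaternion.normSq_def']
  ring

theorem normSq_imagUnit (α : Fin 3) : Quaternion.normSq (imagUnit α) = 1 := by
  rw [Quaternion.normSq_def']
  fin_cases α <;> simp [imagUnit]

theorem inner_leftMul_imagUnit (α : Fin 3) (v w : HSpace q) :
    inner ℝ (leftMul q (imagUnit α) v) (leftMul q (imagUnit α) w) = inner ℝ v w :=
  (inner_smul_smul_quaternion _ v w).trans (by rw [normSq_imagUnit, one_mul])

theorem hasFDerivAt_inner_apply {V : Type*} [NormedAddCommGroup V] [InnerProductSpace ℝ V]
    (v w : V) (A : V →L[ℝ] V) :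
    ∃ D : (V →L[ℝ] V) →L[ℝ] ℝ, HasFDerivAt (fun A : V →L[ℝ] V => (inner ℝ (A v) (A w) : ℝ)) D A ∧
      ∀ B, D B = inner ℝ (A v) (B w) + inner ℝ (B v) (A w) := by
  have h1 : ∀ v : V, HasFDerivAt (fun A : V →L[ℝ] V => A v) (ContinuousLinearMap.apply ℝ _ v) A :=
    fun v => (ContinuousLinearMap.apply ℝ V v).hasFDerivAt
  exact ⟨_, (h1 v).inner ℝ (h1 w), fun B => by simp [fderivInnerCLM_apply]⟩

end Symplectic

/-! ### Representations into Sp(q) and skewness of their differential. -/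

section Representation

variable {E : Type*} [NormedAddCommGroup E] [NormedSpace ℝ E]
  {H : Type*} [TopologicalSpace H] {I : ModelWithCorners ℝ E H}
  {G : Type*} [TopologicalSpace G] [ChartedSpace H G] [Group G] {q : ℕ}

/-- From π(b) = π(ba⁻¹)π(a), the vector x is the right translate of u to the identity. -/
theorem QuaternionicRep.mvfderiv_realRep [LieGroup I ∞ G] (π : QuaternionicRep I G q) (a : G)
    (u : TangentSpace I a) : ∃ x : E, mvfderiv I π.realRep a u = (π.deriv x).comp (π.realRep a) := by
  have hR : MDifferentiableAt I I (fun b : G => b * a⁻¹) a :=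
    (contMDiff_mul_right (I := I) (n := ∞) (a := a⁻¹)).mdifferentiable (by simp) a
  refine ⟨mfderiv I I (fun b : G => b * a⁻¹) a u, ?_⟩
  have h1 : π.realRep = fun b => ((ContinuousLinearMap.compL ℝ (HSpace q) (HSpace q)
      (HSpace q)).flip (π.realRep a)) ((π.realRep ∘ fun b => b * a⁻¹) b) := by
    funext b
    have := π.realRep_mul (b * a⁻¹) a
    rw [inv_mul_cancel_right] at this
    exact this
  have h2 : MDifferentiableAt I 𝓘(ℝ, HSpace q →L[ℝ] HSpace q) π.realRep (a * a⁻¹) :=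
    π.mdifferentiable_realRep _
  conv_lhs => rw [h1]
  rw [mvfderiv_apply_const (MDifferentiableAt.comp a h2 hR)]
  have h3 := mfderiv_comp_apply_of_eq (I' := I) (y := (1 : G)) a (π.mdifferentiable_realRep 1) hR
    (mul_inv_cancel a) u
  exact congrArg (fun T : HSpace q →L[ℝ] HSpace q => T.comp (π.realRep a)) h3

theorem QuaternionicRep.mvfderiv_inner [LieGroup I ∞ G] (π : QuaternionicRep I G q) (a : G)
    (u : TangentSpace I a) (v w : HSpace q) :
    mvfderiv I (fun b => (inner ℝ (π.realRep b v) (π.realRep b w) : ℝ)) a u =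
      inner ℝ (π.realRep a v) (mvfderiv I π.realRep a u w)
        + inner ℝ (mvfderiv I π.realRep a u v) (π.realRep a w) := by
  obtain ⟨D, hD, hD'⟩ := hasFDerivAt_inner_apply v w (π.realRep a)
  have h3 := (hD.hasMFDerivAt.comp a (π.mdifferentiable_realRep a).hasMFDerivAt).mfderiv
  exact (DFunLike.congr_fun h3 u).trans (hD' _)

theorem QuaternionicRep.mdifferentiable_inner (π : QuaternionicRep I G q) (v w : HSpace q) :
    MDifferentiable I 𝓘(ℝ, ℝ) (fun b => (inner ℝ (π.realRep b v) (π.realRep b w) : ℝ)) := by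
  intro a
  obtain ⟨D, hD, -⟩ := hasFDerivAt_inner_apply v w (π.realRep a)
  exact (hD.hasMFDerivAt.comp a (π.mdifferentiable_realRep a).hasMFDerivAt).mdifferentiableAt

/-- One direction differentiates the constant function ⟨π(b)v, π(b)w⟩ at the identity. Conversely,
its derivative at any b is the symmetric part of some dπ(x) evaluated on π(b)v and π(b)w, so it
vanishes, and connectedness compares b with 1. -/
theorem QuaternionicRep.mem_Sp_iff_deriv_skew [LieGroup I ∞ G] [I.Boundaryless] [ConnectedSpace G]
    (π : QuaternionicRep I G q) :
    (∀ a, π.toHom a ∈ Sp q) ↔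
      ∀ (x : E) (v w : HSpace q), inner ℝ (π.deriv x v) w = -inner ℝ v (π.deriv x w) := by
  constructor
  · intro h x v w
    have h1 : (fun b => (inner ℝ (π.realRep b v) (π.realRep b w) : ℝ)) = fun _ => inner ℝ v w :=
      funext fun b => (mem_Sp_iff _).1 (h b) v w
    have h2 := π.mvfderiv_inner (1 : G) x v w
    rw [h1, mvfderiv_const, π.realRep_one] at h2
    have h3 : (0 : ℝ) = inner ℝ v (π.deriv x w) + inner ℝ (π.deriv x v) w := h2
    linarith
  · intro h a
    rw [mem_Sp_iff]
    intro v w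
    have hc : IsLocallyConstant (fun b => (inner ℝ (π.realRep b v) (π.realRep b w) : ℝ)) := by
      refine isLocallyConstant_of_mvfderiv_eq_zero (I := I) (π.mdifferentiable_inner v w) fun b => ?_
      ext u
      rw [π.mvfderiv_inner]
      obtain ⟨x, hx⟩ := π.mvfderiv_realRep b u
      rw [hx]
      change inner ℝ (π.realRep b v) (π.deriv x (π.realRep b w))
        + inner ℝ (π.deriv x (π.realRep b v)) (π.realRep b w) = (0 : ℝ)
      rw [h]
      ring
    have := hc.apply_eq_of_preconnectedSpace a 1
    simp only [π.realRep_one] at this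
    exact this

end Representation
end HKT

namespace HKT

/-- A vector space with a skew bracket, three endomorphisms and a bilinear form: the data of a
left-invariant structure read on the Lie algebra. -/
structure LieData (L : Type*) [AddCommGroup L] [Module ℝ L] where
  J : Fin 3 → L →ₗ[ℝ] L
  g : L →ₗ[ℝ] L →ₗ[ℝ] ℝ
  br : L →ₗ[ℝ] L →ₗ[ℝ] L
  br_swap : ∀ x y, br x y = -br y x

namespace LieData

/-! ### Hyper-Hermitian Lie algebras and their connections. -/

section Basic

variable {L : Type*} [AddCommGroup L] [Module ℝ L] (A : LieData L)

/-- The hyper-Hermitian conditions on the Lie algebra. -/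
structure IsHyperHermitian : Prop where
  sq_J : ∀ α x, A.J α (A.J α x) = -x
  J_zero_one : ∀ x, A.J 0 (A.J 1 x) = A.J 2 x
  J_one_zero : ∀ x, A.J 1 (A.J 0 x) = -A.J 2 x
  integrable : ∀ α x y, A.J α (A.br x y - A.br (A.J α x) (A.J α y))
    - (A.br (A.J α x) y + A.br x (A.J α y)) = 0
  g_symm : ∀ x y, A.g x y = A.g y x
  g_pos : ∀ x, x ≠ 0 → 0 < A.g x x
  g_compat : ∀ α x y, A.g (A.J α x) (A.J α y) = A.g x y

/-- The torsion of an invariant connection `∇_x y = B x y`. -/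
def torsion (B : L → L → L) (x y : L) : L := B x y - B y x - A.br x y

/-- The covariant torsion tensor `g(x, T(y,z))`. -/
def torsionForm (B : L → L → L) (x y z : L) : ℝ := A.g x (A.torsion B y z)

/-- The invariant connection `B` preserves `g`. -/
def IsMetric (B : L → L → L) : Prop := ∀ x y z, A.g (B x y) z + A.g y (B x z) = 0

/-- Invariant hyper-Hermitian connections with skew-symmetric torsion. -/
structure IsHKTConnection (B : L → L → L) : Prop where
  metric : A.IsMetric B
  quaternionic : ∀ α x y, B x (A.J α y) = A.J α (B x y)
  skew_left : ∀ x y z, A.torsionForm B x y z = -A.torsionForm B y x z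
  skew_right : ∀ x y z, A.torsionForm B x y z = -A.torsionForm B x z y

/-- The Levi-Civita connection of an invariant metric. -/
structure IsLeviCivita (B : L → L → L) : Prop where
  metric : A.IsMetric B
  torsion_free : ∀ x y, A.torsion B x y = 0

/-- The exterior derivative of the invariant form `ω_α`. -/
def dKahler (α : Fin 3) (x y z : L) : ℝ :=
  -A.g (A.J α (A.br x y)) z + A.g (A.J α (A.br x z)) y - A.g (A.J α (A.br y z)) x

/-- The exterior derivative of an invariant 3-form. -/
def dThree (c : L → L → L → ℝ) (x y z w : L) : ℝ :=
  -c (A.br x y) z w + c (A.br x z) y w - c (A.br x w) y z - c (A.br y z) x w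
    + c (A.br y w) x z - c (A.br z w) x y

/-- The form `dω_α(J_α x, J_α y, J_α z)`, the only candidate for the torsion form of an HKT
connection. -/
def bismutForm (α : Fin 3) (x y z : L) : ℝ := A.dKahler α (A.J α x) (A.J α y) (A.J α z)

/-- `-(∇ω_α)(x, x', y)` for an invariant connection. -/
def covKahler (B : L → L → L) (α : Fin 3) (x x' y : L) : ℝ :=
  A.g (A.J α (B x x')) y + A.g (A.J α x') (B x y)

/-- A family of vectors orthonormal for `g`. -/
def IsOrthonormal {n : ℕ} (e : Fin n → L) : Prop := ∀ i j, A.g (e i) (e j) = if i = j then 1 else 0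

/-- `d*ω_α = 0`, for the given Levi-Civita connection. -/
def IsCoclosed (B : L → L → L) (α : Fin 3) : Prop :=
  ∀ e : Fin (Module.finrank ℝ L) → L, A.IsOrthonormal e →
    ∀ y, ∑ i, A.covKahler B α (e i) (e i) y = 0

variable {A}

theorem IsHyperHermitian.g_J_left (h : A.IsHyperHermitian) (α : Fin 3) (x y : L) :
    A.g (A.J α x) y = -A.g x (A.J α y) := by
  have := h.g_compat α x (A.J α y)
  rw [h.sq_J, map_neg] at this
  linarith

theorem IsHyperHermitian.eq_zero (h : A.IsHyperHermitian) {x : L} (hx : A.g x x = 0) : x = 0 := by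
  by_contra hne
  exact (h.g_pos x hne).ne' hx

/-- Uniqueness of the torsion of an HKT connection. -/
theorem IsHKTConnection.torsionForm_eq {B : L → L → L} (hB : A.IsHKTConnection B)
    (h : A.IsHyperHermitian) (α : Fin 3) (x y z : L) :
    A.torsionForm B x y z = A.bismutForm α x y z := by
  have hbr : ∀ x y, A.br x y = B x y - B y x - A.torsion B x y := fun x y => by
    simp only [torsion]; abel
  -- B_x and J_α are commuting skew operators, so their product is symmetric.
  have hsym : ∀ x y z, A.g (A.J α (B x y)) z = A.g (A.J α (B x z)) y := fun x y z => by
    rw [← hB.quaternionic, ← hB.quaternionic]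
    have h1 := hB.metric x (A.J α y) z
    have h2 := h.g_J_left α y (B x z)
    have h3 := h.g_symm y (A.J α (B x z))
    rw [hB.quaternionic α x z]
    linarith
  -- Writing the bracket as B(x,y) - B(y,x) - T(x,y), the B terms cancel in pairs by `hsym` and only
  -- torsion survives.
  have hd : ∀ x y z, A.dKahler α x y z = -A.torsionForm B (A.J α z) x y
      - A.torsionForm B (A.J α x) y z - A.torsionForm B (A.J α y) z x := fun x y z => by
    have e1 : ∀ u v w, A.g (A.J α (A.torsion B u v)) w = -A.torsionForm B (A.J α w) u v := by
      intro u v w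
      rw [h.g_J_left, h.g_symm]
      rfl
    have h1 := hsym x y z
    have h2 := hsym y x z
    have h3 := hsym z x y
    have h4 := hB.skew_right (A.J α y) x z
    simp only [dKahler, hbr, map_sub, LinearMap.sub_apply, e1]
    linarith
  -- Integrability of J_α, with the bracket again expressed through B and T: the (3,0) and (0,3)
  -- parts of the torsion form vanish.
  have hN : ∀ u v w, A.torsionForm B w u v - A.torsionForm B w (A.J α u) (A.J α v)
      - A.torsionForm B (A.J α w) (A.J α u) v - A.torsionForm B (A.J α w) u (A.J α v) = 0 := by
    intro u v w
    have e1 : ∀ a b, A.torsionForm B (A.J α w) a b = -A.g w (A.J α (A.torsion B a b)) := fun a b =>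
      h.g_J_left α w _
    have h1 := h.integrable α u v
    have h2 : A.torsion B u v - A.torsion B (A.J α u) (A.J α v) + A.J α (A.torsion B (A.J α u) v)
        + A.J α (A.torsion B u (A.J α v)) = 0 := by
      have h3 : A.J α (A.J α (A.br u v - A.br (A.J α u) (A.J α v))
          - (A.br (A.J α u) v + A.br u (A.J α v))) = 0 := by rw [h1, map_zero]
      simp only [map_sub, map_add, h.sq_J] at h3
      simp only [torsion, hB.quaternionic, map_sub, h.sq_J]
      rw [← h3]
      abel
    have h3 := congrArg (A.g w) h2
    rw [map_add, map_add, map_sub, map_zero] at h3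
    rw [e1, e1]
    simp only [torsionForm] at *
    linarith
  rw [bismutForm, hd]
  have hJ : ∀ u v w, A.torsionForm B (A.J α (A.J α u)) v w = -A.torsionForm B u v w := by
    intro u v w
    simp only [torsionForm, h.sq_J, map_neg, LinearMap.neg_apply]
  rw [hJ, hJ, hJ]
  -- By `hd` the right side is c(z,Jx,Jy) + c(x,Jy,Jz) + c(y,Jz,Jx); moving the arguments by skew
  -- symmetry makes this the expression that `hN` equates with c(x,y,z).
  have h1 := hN y z x
  have h2 := hB.skew_left y (A.J α z) (A.J α x)
  have h3 := hB.skew_left (A.J α x) (A.J α y) z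
  have h4 := hB.skew_right (A.J α y) (A.J α x) z
  have h5 := hB.skew_right (A.J α y) z (A.J α x)
  have h6 := hB.skew_left (A.J α z) y (A.J α x)
  have h7 := hB.skew_right (A.J α x) y (A.J α z)
  have h8 := hB.skew_left (A.J α x) (A.J α z) y
  have h9 := hB.skew_left z (A.J α x) (A.J α y)
  have h10 := hB.skew_right (A.J α x) z (A.J α y)
  have h11 := hB.skew_right (A.J α z) y (A.J α x)
  linarith

theorem IsLeviCivita.koszul {B : L → L → L} (hB : A.IsLeviCivita B) (h : A.IsHyperHermitian)
    (x y z : L) :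
    2 * A.g (B x y) z = A.g (A.br x y) z - A.g (A.br y z) x + A.g (A.br z x) y := by
  have ht : ∀ u v, A.br u v = B u v - B v u := fun u v => by
    have := hB.torsion_free u v
    simp only [torsion] at this
    exact (sub_eq_zero.1 this).symm
  rw [ht, ht, ht]
  simp only [map_sub, LinearMap.sub_apply]
  have h1 := hB.metric x y z
  have h2 := hB.metric y x z
  have h3 := hB.metric z x y
  have h4 := h.g_symm y (B x z)
  have h5 := h.g_symm x (B y z)
  have h6 := h.g_symm x (B z y)
  linarith

theorem IsLeviCivita.unique {B B' : L → L → L} (hB : A.IsLeviCivita B) (hB' : A.IsLeviCivita B')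
    (h : A.IsHyperHermitian) (x y : L) : B x y = B' x y := by
  have key : ∀ z, A.g (B x y - B' x y) z = 0 := fun z => by
    have h1 := hB.koszul h x y z
    have h2 := hB'.koszul h x y z
    rw [map_sub, LinearMap.sub_apply]
    linarith
  exact sub_eq_zero.1 (h.eq_zero (key _))

/-- The inner product defined by the metric. -/
abbrev IsHyperHermitian.core (h : A.IsHyperHermitian) : InnerProductSpace.Core ℝ L where
  inner x y := A.g x y
  conj_inner_symm x y := h.g_symm y x
  re_inner_nonneg x := by
    by_cases hx : x = 0
    · simp [hx]
    · exact (h.g_pos x hx).le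
  add_left x y z := by simp
  smul_left x y r := by simp
  definite x hx := h.eq_zero hx

theorem IsHyperHermitian.exists_orthonormal [FiniteDimensional ℝ L] (h : A.IsHyperHermitian) :
    ∃ e : Fin (Module.finrank ℝ L) → L, A.IsOrthonormal e := by
  let := h.core.toNormedAddCommGroup
  let : InnerProductSpace ℝ L := InnerProductSpace.ofCore h.core.toCore
  have h1 := (stdOrthonormalBasis ℝ L).orthonormal
  rw [orthonormal_iff_ite] at h1
  exact ⟨_, h1⟩

theorem IsHyperHermitian.parseval [FiniteDimensional ℝ L] (h : A.IsHyperHermitian)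
    {e : Fin (Module.finrank ℝ L) → L} (he : A.IsOrthonormal e) (x y : L) :
    ∑ i, A.g x (e i) * A.g (e i) y = A.g x y := by
  let := h.core.toNormedAddCommGroup
  let : InnerProductSpace ℝ L := InnerProductSpace.ofCore h.core.toCore
  have he' : Orthonormal ℝ e := orthonormal_iff_ite.2 he
  have hsp : ⊤ ≤ Submodule.span ℝ (Set.range e) :=
    (he'.linearIndependent.span_eq_top_of_card_eq_finrank' (by simp)).ge
  have := (OrthonormalBasis.mk he' hsp).sum_inner_mul_inner x y
  simp only [OrthonormalBasis.coe_mk] at this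
  exact this

theorem IsHyperHermitian.expand [FiniteDimensional ℝ L] (h : A.IsHyperHermitian)
    {e : Fin (Module.finrank ℝ L) → L} (he : A.IsOrthonormal e) (x : L) :
    x = ∑ i, A.g x (e i) • e i := by
  have key : ∀ y, A.g (x - ∑ i, A.g x (e i) • e i) y = 0 := fun y => by
    rw [map_sub, LinearMap.sub_apply, map_sum, LinearMap.sum_apply]
    simp only [map_smul, LinearMap.smul_apply, smul_eq_mul, h.parseval he, sub_self]
  exact sub_eq_zero.1 (h.eq_zero (key _))

end Basic
end LieData
end HKT

namespace HKT
namespace LieData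

/-! ### The algebraic semidirect product: hyper-Hermitian, HKT and balanced conditions. -/

section Semidirect

variable {L : Type*} [AddCommGroup L] [Module ℝ L]
  {V : Type*} [NormedAddCommGroup V] [InnerProductSpace ℝ V]

/-- A Euclidean space with three orthogonal endomorphisms satisfying the quaternion relations. -/
structure IsQuaternionicSpace (u : Fin 3 → V →ₗ[ℝ] V) : Prop where
  sq : ∀ α v, u α (u α v) = -v
  zero_one : ∀ v, u 0 (u 1 v) = u 2 v
  one_zero : ∀ v, u 1 (u 0 v) = -u 2 v
  inner_compat : ∀ α v w, inner ℝ (u α v) (u α w) = inner ℝ v w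

/-- The data on the semidirect product `L ⋉ V`. -/
def semidirect (A : LieData L) (u : Fin 3 → V →ₗ[ℝ] V) (ρ : L →ₗ[ℝ] V →ₗ[ℝ] V) :
    LieData (L × V) where
  J α := LinearMap.prodMap (A.J α) (u α)
  g := A.g.compl₁₂ (LinearMap.fst ℝ L V) (LinearMap.fst ℝ L V)
    + (innerₗ V).compl₁₂ (LinearMap.snd ℝ L V) (LinearMap.snd ℝ L V)
  br := LinearMap.mk₂ ℝ (fun z z' => (A.br z.1 z'.1, ρ z.1 z'.2 - ρ z'.1 z.2))
    (fun a b c => by ext <;> simp; abel) (fun a b c => by ext <;> simp [smul_sub])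
    (fun a b c => by ext <;> simp; abel) (fun a b c => by ext <;> simp [smul_sub])
  br_swap x y := by
    refine Prod.ext (A.br_swap _ _) ?_
    simp

variable {A : LieData L} {u : Fin 3 → V →ₗ[ℝ] V} {ρ : L →ₗ[ℝ] V →ₗ[ℝ] V}

@[simp]
theorem semidirect_J (α : Fin 3) (z : L × V) :
    (A.semidirect u ρ).J α z = (A.J α z.1, u α z.2) := rfl

@[simp]
theorem semidirect_g (z z' : L × V) :
    (A.semidirect u ρ).g z z' = A.g z.1 z'.1 + inner ℝ z.2 z'.2 := rfl

@[simp]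
theorem semidirect_br (z z' : L × V) :
    (A.semidirect u ρ).br z z' = (A.br z.1 z'.1, ρ z.1 z'.2 - ρ z'.1 z.2) := rfl

theorem IsQuaternionicSpace.inner_left (hu : IsQuaternionicSpace u) (α : Fin 3) (v w : V) :
    inner ℝ (u α v) w = -inner ℝ v (u α w) := by
  have := hu.inner_compat α v (u α w)
  rw [hu.sq, inner_neg_right] at this
  linarith

/-- The V-component of the Nijenhuis tensor cancels because ρ commutes with each u α and (u α)² =
-1; skewness of ρ plays no role. -/
theorem IsHyperHermitian.semidirect (h : A.IsHyperHermitian) (hu : IsQuaternionicSpace u)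
    (hρ : ∀ α x v, ρ x (u α v) = u α (ρ x v)) : (A.semidirect u ρ).IsHyperHermitian where
  sq_J α z := Prod.ext (h.sq_J α _) (hu.sq α _)
  J_zero_one z := Prod.ext (h.J_zero_one _) (hu.zero_one _)
  J_one_zero z := Prod.ext (h.J_one_zero _) (hu.one_zero _)
  integrable α z z' := by
    refine Prod.ext (h.integrable α z.1 z'.1) ?_
    simp only [semidirect_J, semidirect_br, Prod.snd_sub, Prod.snd_add, map_sub, hρ, hu.sq,
      Prod.snd_zero]
    abel
  g_symm z z' := congrArg₂ (· + ·) (h.g_symm _ _) (real_inner_comm _ _)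
  g_pos z hz := by
    rw [semidirect_g]
    by_cases h1 : z.1 = 0
    · have h2 : z.2 ≠ 0 := fun h2 => hz (Prod.ext h1 h2)
      rw [h1, map_zero, zero_add]
      exact real_inner_self_pos.2 h2
    · exact add_pos_of_pos_of_nonneg (h.g_pos _ h1) real_inner_self_nonneg
  g_compat α z z' := congrArg₂ (· + ·) (h.g_compat α _ _) (hu.inner_compat α _ _)

/-- The connection on `L ⋉ V` extending an invariant connection on `L`. -/
def extendConnection (ρ : L →ₗ[ℝ] V →ₗ[ℝ] V) (B : L →ₗ[ℝ] L →ₗ[ℝ] L) :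
    (L × V) →ₗ[ℝ] (L × V) →ₗ[ℝ] L × V :=
  LinearMap.mk₂ ℝ (fun z z' => (B z.1 z'.1, ρ z.1 z'.2))
    (fun a b c => by ext <;> simp) (fun a b c => by ext <;> simp)
    (fun a b c => by ext <;> simp) (fun a b c => by ext <;> simp)

@[simp]
theorem extendConnection_apply (B : L →ₗ[ℝ] L →ₗ[ℝ] L) (z z' : L × V) :
    extendConnection ρ B z z' = (B z.1 z'.1, ρ z.1 z'.2) := rfl

/-- The connection induced on `L` by a connection on `L ⋉ V`. -/
def restrictConnection (B : (L × V) →ₗ[ℝ] (L × V) →ₗ[ℝ] L × V) : L →ₗ[ℝ] L →ₗ[ℝ] L :=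
  (B.compl₁₂ (LinearMap.inl ℝ L V) (LinearMap.inl ℝ L V)).compr₂ (LinearMap.fst ℝ L V)

/-- The V-component of the bracket is exactly the antisymmetrization of (x, w) ↦ ρ x w, so the
extension creates no new torsion. -/
theorem torsion_extend (B : L →ₗ[ℝ] L →ₗ[ℝ] L) (z z' : L × V) :
    (A.semidirect u ρ).torsion (fun x y => extendConnection ρ B x y) z z' =
      (A.torsion (fun x y => B x y) z.1 z'.1, 0) := by
  refine Prod.ext rfl ?_
  simp [torsion]

theorem torsionForm_extend (B : L →ₗ[ℝ] L →ₗ[ℝ] L) (x y z : L × V) :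
    (A.semidirect u ρ).torsionForm (fun x y => extendConnection ρ B x y) x y z =
      A.torsionForm (fun x y => B x y) x.1 y.1 z.1 := by
  rw [torsionForm, torsion_extend]
  simp [torsionForm]

theorem IsMetric.extend {B : L →ₗ[ℝ] L →ₗ[ℝ] L} (hB : A.IsMetric fun x y => B x y)
    (hskew : ∀ x v w, inner ℝ (ρ x v) w = -inner ℝ v (ρ x w)) :
    (A.semidirect u ρ).IsMetric fun x y => extendConnection ρ B x y := fun x y z => by
  have h1 := hB x.1 y.1 z.1
  have h2 := hskew x.1 y.2 z.2
  simp only [semidirect_g, extendConnection_apply]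
  linarith

theorem IsHKTConnection.extend {B : L →ₗ[ℝ] L →ₗ[ℝ] L} (hB : A.IsHKTConnection fun x y => B x y)
    (hρ : ∀ α x v, ρ x (u α v) = u α (ρ x v))
    (hskew : ∀ x v w, inner ℝ (ρ x v) w = -inner ℝ v (ρ x w)) :
    (A.semidirect u ρ).IsHKTConnection fun x y => extendConnection ρ B x y where
  metric := hB.metric.extend hskew
  quaternionic α x y := Prod.ext (hB.quaternionic α _ _) (hρ α _ _)
  skew_left x y z := by
    rw [torsionForm_extend, torsionForm_extend]
    exact hB.skew_left _ _ _
  skew_right x y z := by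
    rw [torsionForm_extend, torsionForm_extend]
    exact hB.skew_right _ _ _

theorem IsLeviCivita.extend {B : L →ₗ[ℝ] L →ₗ[ℝ] L} (hB : A.IsLeviCivita fun x y => B x y)
    (hskew : ∀ x v w, inner ℝ (ρ x v) w = -inner ℝ v (ρ x w)) :
    (A.semidirect u ρ).IsLeviCivita fun x y => extendConnection ρ B x y where
  metric := hB.metric.extend hskew
  torsion_free x y := by
    rw [torsion_extend, hB.torsion_free]
    rfl

/-- L is a subalgebra on which the bracket has no V-component, so compressing a connection to L
compresses its torsion. As L is also J-stable and orthogonal to V, the HKT and Levi-Civita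
conditions survive. -/
theorem torsion_restrict (B : (L × V) →ₗ[ℝ] (L × V) →ₗ[ℝ] L × V) (x y : L) :
    A.torsion (fun x y => restrictConnection B x y) x y =
      ((A.semidirect u ρ).torsion (fun x y => B x y) (x, 0) (y, 0)).1 := rfl

theorem torsionForm_restrict (B : (L × V) →ₗ[ℝ] (L × V) →ₗ[ℝ] L × V) (x y z : L) :
    A.torsionForm (fun x y => restrictConnection B x y) x y z =
      (A.semidirect u ρ).torsionForm (fun x y => B x y) (x, 0) (y, 0) (z, 0) := by
  rw [torsionForm, torsion_restrict, torsionForm, semidirect_g, inner_zero_left, add_zero]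

theorem IsMetric.restrict {B : (L × V) →ₗ[ℝ] (L × V) →ₗ[ℝ] L × V}
    (hB : (A.semidirect u ρ).IsMetric fun x y => B x y) :
    A.IsMetric fun x y => restrictConnection B x y := fun x y z => by
  have := hB (x, 0) (y, 0) (z, 0)
  simp only [semidirect_g, inner_zero_left, inner_zero_right, add_zero] at this
  exact this

theorem IsHKTConnection.restrict {B : (L × V) →ₗ[ℝ] (L × V) →ₗ[ℝ] L × V}
    (hB : (A.semidirect u ρ).IsHKTConnection fun x y => B x y) :
    A.IsHKTConnection fun x y => restrictConnection B x y where
  metric := hB.metric.restrict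
  quaternionic α x y := by
    have := hB.quaternionic α (x, 0) (y, 0)
    rw [semidirect_J] at this
    simp only [map_zero] at this
    exact congrArg Prod.fst this
  skew_left x y z := by
    simp only [torsionForm_restrict (u := u) (ρ := ρ)]
    exact hB.skew_left _ _ _
  skew_right x y z := by
    simp only [torsionForm_restrict (u := u) (ρ := ρ)]
    exact hB.skew_right _ _ _

theorem IsLeviCivita.restrict {B : (L × V) →ₗ[ℝ] (L × V) →ₗ[ℝ] L × V}
    (hB : (A.semidirect u ρ).IsLeviCivita fun x y => B x y) :
    A.IsLeviCivita fun x y => restrictConnection B x y where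
  metric := hB.metric.restrict
  torsion_free x y := by
    rw [torsion_restrict (u := u) (ρ := ρ), hB.torsion_free]
    rfl

/-- An HKT connection on the semidirect product forces the representation to be orthogonal. -/
theorem IsHKTConnection.skew {B : L × V → L × V → L × V}
    (hB : (A.semidirect u ρ).IsHKTConnection B) (h : A.IsHyperHermitian)
    (hu : IsQuaternionicSpace u) (hρ : ∀ α x v, ρ x (u α v) = u α (ρ x v)) (x : L) (v w : V) :
    inner ℝ (ρ x v) w = -inner ℝ v (ρ x w) := by
  let s : L → V → V → ℝ := fun x v w => inner ℝ (ρ x v) w + inner ℝ v (ρ x w)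
  have hs : ∀ x v w, s x v w = inner ℝ (ρ x v) w + inner ℝ v (ρ x w) := fun _ _ _ => rfl
  have hsymm : ∀ x v w, s x v w = s x w v := fun x v w => by
    rw [hs, hs, real_inner_comm, real_inner_comm _ v, add_comm]
  have hneg : ∀ x v w, s (-x) v w = -s x v w := fun x v w => by
    simp only [hs, map_neg, LinearMap.neg_apply, inner_neg_left, inner_neg_right]
    ring
  have hneg' : ∀ x v w, s x (-v) w = -s x v w := fun x v w => by
    simp only [hs, map_neg, inner_neg_left]
    ring
  have hus : ∀ α x v w, s x (u α v) w = -s x v (u α w) := fun α x v w => by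
    simp only [hs, hρ]
    rw [hu.inner_left, hu.inner_left]
    ring
  -- Only the brackets mixing L and V contribute on such a triple, and they assemble into the
  -- symmetric part of ρ.
  have hform : ∀ α x v w, (A.semidirect u ρ).bismutForm α (x, 0) (0, v) (0, w) =
      -s (A.J α x) (u α v) w := fun α x v w => by
    have h1 : inner ℝ (ρ (A.J α x) (u α w)) v = -inner ℝ (u α v) (ρ (A.J α x) w) := by
      rw [hρ, hu.inner_left, real_inner_comm]
    simp only [bismutForm, dKahler, semidirect_J, semidirect_br, semidirect_g, map_zero,
      LinearMap.zero_apply, sub_zero, hs, inner_zero_right, add_zero, zero_add,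
      hu.inner_compat, h1]
    ring
  -- The torsion form does not depend on α, so the expressions for two complex structures agree.
  have hab : ∀ x v w, s (A.J 0 x) (u 0 v) w = s (A.J 1 x) (u 1 v) w := fun x v w => by
    have h1 := hB.torsionForm_eq (h.semidirect hu hρ) 0 (x, 0) (0, v) (0, w)
    have h2 := hB.torsionForm_eq (h.semidirect hu hρ) 1 (x, 0) (0, v) (0, w)
    rw [hform] at h1 h2
    linarith
  have h1 : ∀ v w, s x (u 0 v) w = s (A.J 2 x) (u 1 v) w := fun v w => by
    have := hab (A.J 0 x) v w
    rw [h.sq_J, h.J_one_zero, hneg, hneg] at this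
    linarith
  -- The substitutions x ↦ J₁x and then v ↦ iv in `hab` lead here. The left side is symmetric in v,
  -- w; the right side is skew by `hus` and `hsymm`, so both vanish.
  have h2 : ∀ v w, s x v w = s (A.J 2 x) (u 2 v) w := fun v w => by
    have := h1 (u 0 v) w
    rw [hu.sq, hu.one_zero, hneg', hneg'] at this
    linarith
  have h3 := h2 v w
  have h4 := h2 w v
  have h5 := hus 2 (A.J 2 x) v w
  have h6 := hsymm (A.J 2 x) v (u 2 w)
  have h7 := hsymm x v w
  have h8 := hs x v w
  linarith

/-- For skew ρ commuting with u α, the operator u α ∘ ρ x is symmetric, and the V-terms cancel in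
pairs. -/
theorem dKahler_semidirect (hu : IsQuaternionicSpace u) (hρ : ∀ α x v, ρ x (u α v) = u α (ρ x v))
    (hskew : ∀ x v w, inner ℝ (ρ x v) w = -inner ℝ v (ρ x w)) (α : Fin 3) (x y z : L × V) :
    (A.semidirect u ρ).dKahler α x y z = A.dKahler α x.1 y.1 z.1 := by
  have key : ∀ x v w, inner ℝ (u α (ρ x v)) w = inner ℝ (u α (ρ x w)) v := fun x v w => by
    rw [← hρ, hskew, hu.inner_left, neg_neg, real_inner_comm]
  have h1 := key x.1 y.2 z.2
  have h2 := key y.1 x.2 z.2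
  have h3 := key z.1 x.2 y.2
  simp only [dKahler, semidirect_J, semidirect_br, semidirect_g, map_sub, inner_sub_left]
  linarith

theorem bismutForm_semidirect (hu : IsQuaternionicSpace u)
    (hρ : ∀ α x v, ρ x (u α v) = u α (ρ x v))
    (hskew : ∀ x v w, inner ℝ (ρ x v) w = -inner ℝ v (ρ x w)) (α : Fin 3) (x y z : L × V) :
    (A.semidirect u ρ).bismutForm α x y z = A.bismutForm α x.1 y.1 z.1 :=
  dKahler_semidirect hu hρ hskew α _ _ _

theorem dThree_semidirect {c : L × V → L × V → L × V → ℝ} {c' : L → L → L → ℝ}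
    (hc : ∀ x y z, c x y z = c' x.1 y.1 z.1) (x y z w : L × V) :
    (A.semidirect u ρ).dThree c x y z w = A.dThree c' x.1 y.1 z.1 w.1 := by
  simp only [dThree, hc, semidirect_br]

variable [FiniteDimensional ℝ L] [FiniteDimensional ℝ V]

/-- The V-terms of the summand cancel by skewness, so it is a quadratic form in the L-component
alone. The trace over L × V of a form pulled back along the orthogonal projection is its trace over
L. -/
theorem sum_covKahler_semidirect (h : A.IsHyperHermitian) (hu : IsQuaternionicSpace u)
    (hρ : ∀ α x v, ρ x (u α v) = u α (ρ x v))
    (hskew : ∀ x v w, inner ℝ (ρ x v) w = -inner ℝ v (ρ x w)) (B : L →ₗ[ℝ] L →ₗ[ℝ] L) (α : Fin 3)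
    {e : Fin (Module.finrank ℝ (L × V)) → L × V} (he : (A.semidirect u ρ).IsOrthonormal e)
    {e' : Fin (Module.finrank ℝ L) → L} (he' : A.IsOrthonormal e') (z : L × V) :
    ∑ i, (A.semidirect u ρ).covKahler (fun x y => extendConnection ρ B x y) α (e i) (e i) z =
      ∑ j, A.covKahler (fun x y => B x y) α (e' j) (e' j) z.1 := by
  have h1 : ∀ x : L × V, (A.semidirect u ρ).covKahler (fun x y => extendConnection ρ B x y) α x x z
      = A.covKahler (fun x y => B x y) α x.1 x.1 z.1 := fun x => by
    simp only [covKahler, semidirect_J, semidirect_g, extendConnection_apply]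
    have : inner ℝ (u α (ρ x.1 x.2)) z.2 + inner ℝ (u α x.2) (ρ x.1 z.2) = (0 : ℝ) := by
      rw [← hρ, hskew]
      ring
    linarith
  let T : L →ₗ[ℝ] L →ₗ[ℝ] ℝ := LinearMap.mk₂ ℝ
    (fun x x' => A.g (A.J α (B x x')) z.1 + A.g (A.J α x') (B x z.1))
    (fun a b c => by simp; ring) (fun a b c => by simp; ring)
    (fun a b c => by simp; ring) (fun a b c => by simp; ring)
  have hT : ∀ x, A.covKahler (fun x y => B x y) α x x z.1 = T x x := fun x => rfl
  simp only [h1, hT]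
  have hexp : ∀ x : L, T x x = ∑ j, ∑ k, A.g x (e' j) * A.g x (e' k) * T (e' j) (e' k) := fun x => by
    conv_lhs => rw [h.expand he' x]
    simp only [map_sum, map_smul, LinearMap.sum_apply, LinearMap.smul_apply, smul_eq_mul,
      Finset.mul_sum]
    rw [Finset.sum_comm]
    refine Finset.sum_congr rfl fun j _ => Finset.sum_congr rfl fun k _ => ?_
    ring
  -- The basis e need not be adapted to the splitting; Parseval applied to (e' j, 0) and (e' k, 0)
  -- replaces such a choice.
  have hpars : ∀ j k, ∑ i, A.g (e i).1 (e' j) * A.g (e i).1 (e' k) = if j = k then 1 else 0 := by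
    intro j k
    have := (h.semidirect hu hρ).parseval he (e' j, 0) (e' k, 0)
    simp only [semidirect_g, inner_zero_left, inner_zero_right, add_zero] at this
    rw [he' j k] at this
    rw [← this]
    exact Finset.sum_congr rfl fun i _ => by rw [h.g_symm (e i).1 (e' j)]
  calc ∑ i, T (e i).1 (e i).1
      = ∑ i, ∑ j, ∑ k, A.g (e i).1 (e' j) * A.g (e i).1 (e' k) * T (e' j) (e' k) :=
        Finset.sum_congr rfl fun i _ => hexp _
    _ = ∑ j, ∑ k, (∑ i, A.g (e i).1 (e' j) * A.g (e i).1 (e' k)) * T (e' j) (e' k) := by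
        rw [Finset.sum_comm]
        refine Finset.sum_congr rfl fun j _ => ?_
        rw [Finset.sum_comm]
        exact Finset.sum_congr rfl fun k _ => (Finset.sum_mul _ _ _).symm
    _ = ∑ j, T (e' j) (e' j) := by simp [hpars]

/-- By uniqueness a Levi-Civita product on L × V is the extension of its own compression, so the
trace comparison applies in both directions. -/
theorem exists_balanced_semidirect_iff (h : A.IsHyperHermitian) (hu : IsQuaternionicSpace u)
    (hρ : ∀ α x v, ρ x (u α v) = u α (ρ x v))
    (hskew : ∀ x v w, inner ℝ (ρ x v) w = -inner ℝ v (ρ x w)) :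
    (∃ B : (L × V) →ₗ[ℝ] (L × V) →ₗ[ℝ] L × V, (A.semidirect u ρ).IsLeviCivita (fun x y => B x y) ∧
        ∀ α, (A.semidirect u ρ).IsCoclosed (fun x y => B x y) α) ↔
      ∃ B : L →ₗ[ℝ] L →ₗ[ℝ] L, A.IsLeviCivita (fun x y => B x y) ∧
        ∀ α, A.IsCoclosed (fun x y => B x y) α := by
  constructor
  · rintro ⟨B, hB, hc⟩
    refine ⟨restrictConnection B, hB.restrict, fun α e' he' y => ?_⟩
    obtain ⟨e, he⟩ := (h.semidirect hu hρ).exists_orthonormal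
    have hBB : (fun x y => B x y) = fun x y => extendConnection ρ (restrictConnection B) x y := by
      funext x y
      exact hB.unique (hB.restrict.extend hskew) (h.semidirect hu hρ) x y
    rw [hBB] at hc
    have h1 := sum_covKahler_semidirect h hu hρ hskew (restrictConnection B) α he he' (y, 0)
    rw [← h1]
    exact hc α e he (y, 0)
  · rintro ⟨B, hB, hc⟩
    refine ⟨extendConnection ρ B, hB.extend hskew, fun α e he z => ?_⟩
    obtain ⟨e', he'⟩ := h.exists_orthonormal
    rw [sum_covKahler_semidirect h hu hρ hskew B α he he' z]
    exact hc α e' he' z.1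

end Semidirect
end LieData
end HKT

namespace HKT
open VectorField Filter Topology

/-! ### Calculus of bilinear expressions on manifolds. -/

section BilinearCalculus

variable {E : Type*} [NormedAddCommGroup E] [NormedSpace ℝ E]
  {H : Type*} [TopologicalSpace H] {I : ModelWithCorners ℝ E H}
  {M : Type*} [TopologicalSpace M] [ChartedSpace H M]
  {E₁ E₂ E₃ : Type*} [NormedAddCommGroup E₁] [NormedSpace ℝ E₁] [FiniteDimensional ℝ E₁]
  [NormedAddCommGroup E₂] [NormedSpace ℝ E₂] [FiniteDimensional ℝ E₂]
  [NormedAddCommGroup E₃] [NormedSpace ℝ E₃]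

theorem contDiff_bilinear (b : E₁ →ₗ[ℝ] E₂ →ₗ[ℝ] E₃) {n : ℕ∞ω} :
    ContDiff ℝ n (fun z : E₁ × E₂ => b z.1 z.2) := by
  have h : (fun z : E₁ × E₂ => b z.1 z.2) = fun z =>
      (LinearMap.toContinuousLinearMap ((LinearMap.toContinuousLinearMap :
        (E₂ →ₗ[ℝ] E₃) ≃ₗ[ℝ] E₂ →L[ℝ] E₃).toLinearMap ∘ₗ b)) z.1 z.2 := rfl
  rw [h]
  exact ((ContinuousLinearMap.contDiff _).comp contDiff_fst).clm_apply contDiff_snd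

theorem hasMFDerivAt_bilinear (b : E₁ →ₗ[ℝ] E₂ →ₗ[ℝ] E₃) {ξ : M → E₁} {η : M → E₂} {p : M}
    (hξ : MDifferentiableAt I 𝓘(ℝ, E₁) ξ p) (hη : MDifferentiableAt I 𝓘(ℝ, E₂) η p) :
    MDifferentiableAt I 𝓘(ℝ, E₃) (fun y => b (ξ y) (η y)) p ∧ ∀ v,
      mvfderiv I (fun y => b (ξ y) (η y)) p v
        = b (mvfderiv I ξ p v) (η p) + b (ξ p) (mvfderiv I η p v) := by
  let B : E₁ →L[ℝ] E₂ →L[ℝ] E₃ := LinearMap.toContinuousLinearMap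
    ((LinearMap.toContinuousLinearMap : (E₂ →ₗ[ℝ] E₃) ≃ₗ[ℝ] E₂ →L[ℝ] E₃).toLinearMap ∘ₗ b)
  have h1 := (B.isBoundedBilinearMap.hasFDerivAt (ξ p, η p)).hasMFDerivAt
  have h2 : HasMFDerivAt I 𝓘(ℝ, E₁ × E₂) (fun y => (ξ y, η y)) p
      ((mvfderiv I ξ p : TangentSpace I p →L[ℝ] E₁).prod
        (mvfderiv I η p : TangentSpace I p →L[ℝ] E₂)) :=
    ⟨hξ.continuousAt.prodMk hη.continuousAt, hξ.hasMFDerivAt.2.prodMk hη.hasMFDerivAt.2⟩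
  have h3 := HasMFDerivAt.comp p h1 h2
  refine ⟨h3.mdifferentiableAt, fun v => (DFunLike.congr_fun h3.mfderiv v).trans ?_⟩
  exact add_comm _ _

theorem contMDiff_bilinear (b : E₁ →ₗ[ℝ] E₂ →ₗ[ℝ] E₃) {ξ : M → E₁} {η : M → E₂} {n : ℕ∞ω}
    (hξ : ContMDiff I 𝓘(ℝ, E₁) n ξ) (hη : ContMDiff I 𝓘(ℝ, E₂) n η) :
    ContMDiff I 𝓘(ℝ, E₃) n (fun y => b (ξ y) (η y)) :=
  (contDiff_bilinear b).contMDiff.comp (hξ.prodMk_space hη)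

omit [FiniteDimensional ℝ E₁] in
theorem contMDiff_mvfderiv_apply [IsManifold I ∞ M] {η : M → E₁} (hη : ContMDiff I 𝓘(ℝ, E₁) ∞ η)
    {X : (p : M) → TangentSpace I p} (hX : IsSmoothField X) :
    ContMDiff I 𝓘(ℝ, E₁) ∞ (fun p => mvfderiv I η p (X p)) := by
  have h1 : ContMDiff I.tangent 𝓘(ℝ, E₁).tangent ∞ (tangentMap I 𝓘(ℝ, E₁) η) :=
    hη.contMDiff_tangentMap (by simp)
  exact ((contMDiff_snd_tangentBundle_modelSpace E₁ 𝓘(ℝ, E₁)).comp h1).comp hX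

end BilinearCalculus

/-! ### Invariant connections and connections read at a point. -/

section Connections

variable {E : Type*} [NormedAddCommGroup E] [NormedSpace ℝ E] [FiniteDimensional ℝ E]
  {H : Type*} [TopologicalSpace H] {I : ModelWithCorners ℝ E H}
  {G : Type*} [TopologicalSpace G] [ChartedSpace H G] [Group G] [LieGroup I ∞ G]

variable (I G) in
/-- The left-invariant connection with `∇_x y = B x y` on left-invariant fields. -/
def invConnection (B : E →ₗ[ℝ] E →ₗ[ℝ] E) :
    CovariantDerivative I E (TangentSpace I : G → Type _) where
  -- The Leibniz rule dictates the value on a general field: differentiate its coefficient function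
  -- and add B.
  toFun Y p := (fromIdentity p : E →L[ℝ] TangentSpace I p) ∘L
    ((mvfderiv I (coframe Y) p : TangentSpace I p →L[ℝ] E)
      + (LinearMap.toContinuousLinearMap (B.flip (coframe Y p)) : E →L[ℝ] E) ∘L
        (toIdentity p : TangentSpace I p →L[ℝ] E))
  isCovariantDerivativeOnUniv := by
    constructor
    · intro σ σ' p hσ hσ' _
      have h1 : coframe (σ + σ') = coframe σ + coframe σ' :=
        funext fun x => map_add (toIdentity x) (σ x) (σ' x)
      have h2 := mvfderiv_add ((mdifferentiableAt_iff_coframe σ p).1 hσ)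
        ((mdifferentiableAt_iff_coframe σ' p).1 hσ')
      ext v
      have h3 : mvfderiv I (coframe σ + coframe σ') p v
          + B (toIdentity p v) (coframe σ p + coframe σ' p)
          = (mvfderiv I (coframe σ) p v + B (toIdentity p v) (coframe σ p) : E)
            + (mvfderiv I (coframe σ') p v + B (toIdentity p v) (coframe σ' p)) := by
        rw [h2, map_add]
        exact add_add_add_comm _ _ _ _
      refine Eq.trans (congrArg (fromIdentity p) (?_ : _ = _)) (map_add (fromIdentity p) _ _)
      exact (congrArg (fun c : G → E => (mvfderiv I c p v + B (toIdentity p v) (c p) : E)) h1).trans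
        h3
    · intro σ f p hσ hf _
      have h1 : coframe (f • σ) = f • coframe σ :=
        funext fun x => map_smul (toIdentity x) (f x) (σ x)
      have h2 := mvfderiv_smul hf ((mdifferentiableAt_iff_coframe σ p).1 hσ)
      ext v
      have h3 : mvfderiv I (f • coframe σ) p v + B (toIdentity p v) (f p • coframe σ p)
          = f p • (mvfderiv I (coframe σ) p v + B (toIdentity p v) (coframe σ p) : E)
            + mvfderiv I f p v • coframe σ p := by
        rw [h2, map_smul, smul_add]
        exact add_right_comm _ _ _
      have h4 : fromIdentity p (f p • (mvfderiv I (coframe σ) p v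
          + B (toIdentity p v) (coframe σ p) : E) + mvfderiv I f p v • coframe σ p : E)
          = f p • fromIdentity p (mvfderiv I (coframe σ) p v
          + B (toIdentity p v) (coframe σ p) : E) + mvfderiv I f p v • σ p := by
        refine (map_add (fromIdentity p) _ _).trans (congrArg₂ (· + ·) (map_smul _ _ _)
          ((map_smul _ _ _).trans (congrArg _ (fromIdentity_toIdentity p (σ p)))))
      refine Eq.trans (congrArg (fromIdentity p) (?_ : _ = _)) h4
      exact (congrArg (fun c : G → E => (mvfderiv I c p v + B (toIdentity p v) (c p) : E)) h1).trans
        h3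

theorem isSmoothConnection_invConnection (B : E →ₗ[ℝ] E →ₗ[ℝ] E) :
    IsSmoothConnection (invConnection I G B) := by
  intro X Y hX hY
  have hY' := (isSmoothField_iff Y).1 hY
  rw [isSmoothField_iff]
  exact ((contMDiff_mvfderiv_apply hY' hX).add
    (contMDiff_bilinear B ((isSmoothField_iff X).1 hX) hY')).congr fun p =>
      toIdentity_fromIdentity p _

/-- A connection at a point, read in the left-invariant trivialization. -/
def connectionAt (D : CovariantDerivative I E (TangentSpace I : G → Type _)) (p : G) (x y : E) : E :=
  toIdentity p (D (invField I y) p (invField I x p))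

theorem connectionAt_invConnection (B : E →ₗ[ℝ] E →ₗ[ℝ] E) (p : G) (x y : E) :
    connectionAt (invConnection I G B) p x y = B x y := by
  refine (toIdentity_fromIdentity p _).trans ?_
  rw [coframe_invField, mvfderiv_const]
  exact (zero_add _).trans (congrArg (fun z => B z y) (toIdentity_fromIdentity p x))

variable (I G) in
/-- The Lie algebra data of a left-invariant structure. -/
def lieData (J₀ : Fin 3 → E →ₗ[ℝ] E) (g₀ : E →ₗ[ℝ] E →ₗ[ℝ] ℝ) : LieData E :=
  haveI : CompleteSpace E := FiniteDimensional.complete ℝ E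
  ⟨J₀, g₀, bracketMap I G, bracketMap_swap⟩

theorem coframe_mlieBracket_lieData (J₀ : Fin 3 → E →ₗ[ℝ] E) (g₀ : E →ₗ[ℝ] E →ₗ[ℝ] ℝ)
    {X Y : (p : G) → TangentSpace I p} (hX : IsSmoothField X) (hY : IsSmoothField Y) (p : G) :
    coframe (mlieBracket I X Y) p = mvfderiv I (coframe Y) p (X p)
      - mvfderiv I (coframe X) p (Y p) + (lieData I G J₀ g₀).br (coframe X p) (coframe Y p) := by
  have : CompleteSpace E := FiniteDimensional.complete ℝ E
  exact coframe_mlieBracket (hX.mdifferentiableAt p) (hY.mdifferentiableAt p)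

/-- Torsion is a tensor, so it may be computed on the invariant fields through v and w. D itself
need not be invariant. -/
theorem toIdentity_torsion (J₀ : Fin 3 → E →ₗ[ℝ] E) (g₀ : E →ₗ[ℝ] E →ₗ[ℝ] ℝ)
    (D : CovariantDerivative I E (TangentSpace I : G → Type _)) (p : G) (v w : TangentSpace I p) :
    toIdentity p (TensorData.torsion D p v w) =
      (lieData I G J₀ g₀).torsion (connectionAt D p) (toIdentity p v) (toIdentity p w) := by
  have hc : CompleteSpace E := FiniteDimensional.complete ℝ E
  have h1 := D.torsion_apply
    ((isSmoothField_invField (I := I) (toIdentity p v : E)).mdifferentiableAt p)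
    ((isSmoothField_invField (I := I) (toIdentity p w : E)).mdifferentiableAt p)
  have h2 := coframe_mlieBracket_invField (I := I) (toIdentity p v : E) (toIdentity p w : E) p
  have hv : invField I (toIdentity p v : E) p = v := fromIdentity_toIdentity p v
  have hw : invField I (toIdentity p w : E) p = w := fromIdentity_toIdentity p w
  have h3 : TensorData.torsion D p v w =
      D.torsion p (invField I (toIdentity p v : E) p) (invField I (toIdentity p w : E) p) := by
    rw [hv, hw]; rfl
  rw [h3, h1]
  refine (map_sub (toIdentity p) _ _).trans (congrArg₂ (· - ·) (map_sub (toIdentity p) _ _) h2)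

end Connections
end HKT

namespace HKT
open VectorField Filter Topology

/-! ### Hyper-Hermitian conditions for invariant tensors. -/

section InvariantTensors

variable {E : Type*} [NormedAddCommGroup E] [NormedSpace ℝ E] [FiniteDimensional ℝ E]
  {H : Type*} [TopologicalSpace H] {I : ModelWithCorners ℝ E H}
  {G : Type*} [TopologicalSpace G] [ChartedSpace H G] [Group G] [LieGroup I ∞ G]

variable (I G) in
/-- `leftInvariant`, with the Lie algebra written as the model space `E`. -/
def invTensor (J₀ : Fin 3 → E →ₗ[ℝ] E) (g₀ : E →ₗ[ℝ] E →ₗ[ℝ] ℝ) : TensorData I G :=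
  leftInvariant (I := I) (G := G) J₀ g₀

variable {J₀ : Fin 3 → E →ₗ[ℝ] E} {g₀ : E →ₗ[ℝ] E →ₗ[ℝ] ℝ}

omit [FiniteDimensional ℝ E] in
theorem toIdentity_invTensor_J (α : Fin 3) (p : G) (v : TangentSpace I p) :
    (toIdentity p ((invTensor I G J₀ g₀).J α p v) : E) = J₀ α (toIdentity p v : E) :=
  toIdentity_fromIdentity p _

omit [FiniteDimensional ℝ E] in
theorem coframe_invTensor_J (α : Fin 3) (X : (p : G) → TangentSpace I p) :
    coframe (fun p => (invTensor I G J₀ g₀).J α p (X p)) = fun p => J₀ α (coframe X p) :=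
  funext fun p => toIdentity_invTensor_J α p (X p)

omit [FiniteDimensional ℝ E] in
theorem toIdentity_injective {p : G} {v w : TangentSpace I p}
    (h : (toIdentity p v : E) = toIdentity p w) : v = w :=
  (fromIdentity_toIdentity p v).symm.trans
    ((congrArg (fromIdentity p) h).trans (fromIdentity_toIdentity p w))

omit [FiniteDimensional ℝ E] in
theorem invTensor_J_invField (α : Fin 3) (x : E) :
    (fun p => (invTensor I G J₀ g₀).J α p (invField I x p)) = invField I (J₀ α x) :=
  funext fun p => congrArg (fun z => fromIdentity p (J₀ α z)) (toIdentity_fromIdentity p x)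

theorem isSmoothField_invTensor_J (α : Fin 3) {X : (p : G) → TangentSpace I p}
    (hX : IsSmoothField X) : IsSmoothField (fun p => (invTensor I G J₀ g₀).J α p (X p)) := by
  rw [isSmoothField_iff, coframe_invTensor_J]
  exact (LinearMap.toContinuousLinearMap (J₀ α)).contDiff.contMDiff.comp ((isSmoothField_iff X).1 hX)

theorem mvfderiv_linear_comp {M : Type*} [TopologicalSpace M] [ChartedSpace H M] {f : M → E} {x : M}
    (hf : MDifferentiableAt I 𝓘(ℝ, E) f x) (L : E →ₗ[ℝ] E) (v : TangentSpace I x) :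
    mvfderiv I (fun y => L (f y)) x v = L (mvfderiv I f x v) :=
  mvfderiv_apply_const hf (LinearMap.toContinuousLinearMap L) v

/-- J is constant in the coframe, so it commutes with differentiation; the derivative terms of the
four brackets then cancel by J² = -1. -/
theorem coframe_nijenhuis (hsq : ∀ α x, J₀ α (J₀ α x) = -x) (α : Fin 3)
    {X Y : (p : G) → TangentSpace I p} (hX : IsSmoothField X) (hY : IsSmoothField Y) (p : G) :
    (coframe (nijenhuis ((invTensor I G J₀ g₀).J α) X Y) p : E) =
      J₀ α ((lieData I G J₀ g₀).br (coframe X p) (coframe Y p)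
        - (lieData I G J₀ g₀).br (J₀ α (coframe X p)) (J₀ α (coframe Y p)))
      - ((lieData I G J₀ g₀).br (J₀ α (coframe X p)) (coframe Y p)
        + (lieData I G J₀ g₀).br (coframe X p) (J₀ α (coframe Y p))) := by
  let S := invTensor I G J₀ g₀
  have hJX : IsSmoothField (fun p => S.J α p (X p)) := isSmoothField_invTensor_J α hX
  have hJY : IsSmoothField (fun p => S.J α p (Y p)) := isSmoothField_invTensor_J α hY
  have b1 := coframe_mlieBracket_lieData J₀ g₀ hX hY p
  have b2 := coframe_mlieBracket_lieData J₀ g₀ hJX hJY p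
  have b3 := coframe_mlieBracket_lieData J₀ g₀ hJX hY p
  have b4 := coframe_mlieBracket_lieData J₀ g₀ hX hJY p
  have dX : ∀ v, mvfderiv I (coframe (fun p => S.J α p (X p))) p v
      = J₀ α (mvfderiv I (coframe X) p v) := fun v => by
    rw [coframe_invTensor_J]
    exact mvfderiv_linear_comp (hX.coframe_mdifferentiableAt p) _ v
  have dY : ∀ v, mvfderiv I (coframe (fun p => S.J α p (Y p))) p v
      = J₀ α (mvfderiv I (coframe Y) p v) := fun v => by
    rw [coframe_invTensor_J]
    exact mvfderiv_linear_comp (hY.coframe_mdifferentiableAt p) _ v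
  have cX : coframe (fun p => S.J α p (X p)) p = J₀ α (coframe X p) :=
    congrFun (coframe_invTensor_J α X) p
  have cY : coframe (fun p => S.J α p (Y p)) p = J₀ α (coframe Y p) :=
    congrFun (coframe_invTensor_J α Y) p
  have h0 : coframe (nijenhuis (S.J α) X Y) p =
      J₀ α (coframe (mlieBracket I X Y) p
        - coframe (mlieBracket I (fun y => S.J α y (X y)) (fun y => S.J α y (Y y))) p)
      - (coframe (mlieBracket I (fun y => S.J α y (X y)) Y) p
        + coframe (mlieBracket I X (fun y => S.J α y (Y y))) p) :=
    (map_sub (toIdentity p) _ _).trans (congrArg₂ (· - ·)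
      ((toIdentity_invTensor_J α p _).trans (congrArg (J₀ α) (map_sub (toIdentity p) _ _)))
      (map_add (toIdentity p) _ _))
  rw [h0, b1, b2, b3, b4, dX, dX, dY, dY, cX, cY]
  simp only [map_sub, map_add, hsq]
  abel

theorem isHyperHermitian_invTensor_iff :
    (invTensor I G J₀ g₀).IsHyperHermitian ↔ (lieData I G J₀ g₀).IsHyperHermitian := by
  have hJ : ∀ α (p : G) (v : TangentSpace I p),
    (toIdentity p ((invTensor I G J₀ g₀).J α p v) : E) = J₀ α (toIdentity p v : E) :=
    toIdentity_invTensor_J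
  have hinv : ∀ (p : G) (x : E), (toIdentity p (invField I x p) : E) = x :=
    fun p x => toIdentity_fromIdentity p x
  constructor
  · intro h
    have hsq : ∀ α x, J₀ α (J₀ α x) = -x := fun α x => by
      have := congrArg (toIdentity (1 : G)) (h.sq_J α 1 (invField I x 1))
      rw [map_neg] at this
      exact ((congrArg (J₀ α) ((hJ α 1 _).trans (congrArg (J₀ α) (hinv 1 x)))).symm.trans
        (hJ α 1 _).symm).trans (this.trans (congrArg Neg.neg (hinv 1 x)))
    have hJJ : ∀ α β x, (toIdentity (1 : G) ((invTensor I G J₀ g₀).J α 1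
        ((invTensor I G J₀ g₀).J β 1 (invField I x 1))) : E) = J₀ α (J₀ β x) := fun α β x =>
      (hJ α 1 _).trans (congrArg (J₀ α) ((hJ β 1 _).trans (congrArg (J₀ β) (hinv 1 x))))
    have hJ1 : ∀ α x, (toIdentity (1 : G) ((invTensor I G J₀ g₀).J α 1 (invField I x 1)) : E)
        = J₀ α x := fun α x => (hJ α 1 _).trans (congrArg (J₀ α) (hinv 1 x))
    have hg : ∀ x y, (invTensor I G J₀ g₀).g 1 (invField I x 1) (invField I y 1) = g₀ x y :=
      fun x y => congrArg₂ (fun a b => g₀ a b) (hinv 1 x) (hinv 1 y)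
    refine ⟨hsq, fun x => ?_, fun x => ?_, fun α x y => ?_, fun x y => ?_, fun x hx => ?_,
      fun α x y => ?_⟩
    · exact (hJJ 0 1 x).symm.trans ((congrArg (toIdentity (1 : G))
        (h.J_zero_one 1 (invField I x 1))).trans (hJ1 2 x))
    · exact (hJJ 1 0 x).symm.trans ((congrArg (toIdentity (1 : G))
        (h.J_one_zero 1 (invField I x 1))).trans ((map_neg (toIdentity (1 : G)) _).trans
          (congrArg Neg.neg (hJ1 2 x))))
    · have h1 := coframe_nijenhuis (g₀ := g₀) hsq α (isSmoothField_invField (I := I) (G := G) x)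
        (isSmoothField_invField (I := I) (G := G) y) 1
      rw [coframe_invField, coframe_invField] at h1
      refine h1.symm.trans ((congrArg (toIdentity (1 : G)) (h.integrable α _ _
        (isSmoothField_invField x) (isSmoothField_invField y) 1)).trans
          (map_zero (toIdentity (1 : G))))
    · exact (hg x y).symm.trans ((h.g_symm 1 _ _).trans (hg y x))
    · refine lt_of_lt_of_eq (h.g_pos 1 (invField I x 1) fun h0 => hx ?_) (hg x x)
      exact (hinv 1 x).symm.trans ((congrArg (toIdentity (1 : G)) h0).trans
        (map_zero (toIdentity (1 : G))))
    · exact (congrArg₂ (fun a b => g₀ a b) (hJ1 α x) (hJ1 α y)).symm.trans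
        ((h.g_compat α 1 (invField I x 1) (invField I y 1)).trans (hg x y))
  · intro h
    have hsq : ∀ α x, J₀ α (J₀ α x) = -x := h.sq_J
    refine ⟨fun α X hX => isSmoothField_invTensor_J α hX, fun X Y hX hY => ?_, fun α p v => ?_,
      fun p v => ?_, fun p v => ?_, fun α X Y hX hY p => ?_, fun p v w => ?_, fun p v hv => ?_,
      fun α p v w => ?_⟩
    · exact contMDiff_bilinear g₀ ((isSmoothField_iff X).1 hX) ((isSmoothField_iff Y).1 hY)
    · refine toIdentity_injective ((hJ α p _).trans ((congrArg (J₀ α) (hJ α p v)).trans ?_))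
      exact (h.sq_J α _).trans (map_neg (toIdentity p) v).symm
    · refine toIdentity_injective ((hJ 0 p _).trans ((congrArg (J₀ 0) (hJ 1 p v)).trans ?_))
      exact (h.J_zero_one _).trans (hJ 2 p v).symm
    · refine toIdentity_injective ((hJ 1 p _).trans ((congrArg (J₀ 1) (hJ 0 p v)).trans ?_))
      exact (h.J_one_zero _).trans ((congrArg Neg.neg (hJ 2 p v).symm).trans
        (map_neg (toIdentity p) _).symm)
    · refine toIdentity_injective (((coframe_nijenhuis (g₀ := g₀) hsq α hX hY p).trans ?_).trans
        (map_zero (toIdentity p)).symm)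
      exact h.integrable α _ _
    · exact h.g_symm _ _
    · refine h.g_pos _ fun h0 => hv (toIdentity_injective (h0.trans (map_zero (toIdentity p)).symm))
    · exact (congrArg₂ (fun a b => g₀ a b) (hJ α p v) (hJ α p w)).trans (h.g_compat α _ _)

end InvariantTensors
end HKT

namespace HKT
open VectorField Filter Topology

/-! ### Metric, HKT and Levi-Civita connections, and closed Kähler forms. -/

section InvariantConnections

variable {E : Type*} [NormedAddCommGroup E] [NormedSpace ℝ E] [FiniteDimensional ℝ E]
  {H : Type*} [TopologicalSpace H] {I : ModelWithCorners ℝ E H}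
  {G : Type*} [TopologicalSpace G] [ChartedSpace H G] [Group G] [LieGroup I ∞ G]
  {J₀ : Fin 3 → E →ₗ[ℝ] E} {g₀ : E →ₗ[ℝ] E →ₗ[ℝ] ℝ}

omit [FiniteDimensional ℝ E] [LieGroup I ∞ G] in
theorem invTensor_g_coframe (X Y : (p : G) → TangentSpace I p) :
    (fun p => (invTensor I G J₀ g₀).g p (X p) (Y p)) = fun p => g₀ (coframe X p) (coframe Y p) :=
  rfl

-- The invariant field depends linearly on its value at 1 with constant coefficients, so the
-- derivative term of the Leibniz rule is absent and D becomes linear in that argument too.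
omit [FiniteDimensional ℝ E] in
theorem exists_bilinear_connectionAt (D : CovariantDerivative I E (TangentSpace I : G → Type _))
    (p : G) : ∃ B : E →ₗ[ℝ] E →ₗ[ℝ] E, (fun x y => B x y) = connectionAt D p := by
  have hs : ∀ y : E, MDifferentiableAt I I.tangent
      (fun x : G => (⟨x, invField I y x⟩ : TangentBundle I G)) p := fun y =>
    (isSmoothField_invField y).mdifferentiableAt p
  have hadd : ∀ y y' : E, (invField I (y + y') : (p : G) → TangentSpace I p)
      = invField I y + invField I y' := fun y y' => funext fun p => map_add (fromIdentity p) y y'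
  have hsmul : ∀ (r : ℝ) (y : E), (invField I (r • y) : (p : G) → TangentSpace I p)
      = r • invField I y := fun r y => funext fun p => map_smul (fromIdentity p) r y
  refine ⟨LinearMap.mk₂ ℝ (connectionAt D p) (fun x x' y => ?_) (fun r x y => ?_)
    (fun x y y' => ?_) (fun r x y => ?_), rfl⟩
  · have h : D (invField I y) p (invField I (x + x') p)
        = D (invField I y) p (invField I x p) + D (invField I y) p (invField I x' p) := by
      rw [hadd]; exact map_add _ _ _
    exact (congrArg (toIdentity p) h).trans (map_add (toIdentity p) _ _)
  · have h : D (invField I y) p (invField I (r • x) p)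
        = r • D (invField I y) p (invField I x p) := by
      rw [hsmul]; exact map_smul _ _ _
    exact (congrArg (toIdentity p) h).trans (map_smul (toIdentity p) _ _)
  · have h : D (invField I (y + y')) p (invField I x p)
        = D (invField I y) p (invField I x p) + D (invField I y') p (invField I x p) := by
      rw [hadd]
      exact DFunLike.congr_fun (D.isCovariantDerivativeOnUniv.add (hs y) (hs y')) _
    exact (congrArg (toIdentity p) h).trans (map_add (toIdentity p) _ _)
  · have h : D (invField I (r • y)) p (invField I x p)
        = r • D (invField I y) p (invField I x p) := by
      rw [hsmul]
      exact DFunLike.congr_fun (D.isCovariantDerivativeOnUniv.smul_const r (hs y)) _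
    exact (congrArg (toIdentity p) h).trans (map_smul (toIdentity p) _ _)

theorem torsionForm_invTensor (D : CovariantDerivative I E (TangentSpace I : G → Type _)) (p : G)
    (u v w : TangentSpace I p) : (invTensor I G J₀ g₀).torsionForm D p u v w =
      (lieData I G J₀ g₀).torsionForm (connectionAt D p) (toIdentity p u) (toIdentity p v)
        (toIdentity p w) :=
  congrArg (fun z : E => g₀ (toIdentity p u : E) z) (toIdentity_torsion J₀ g₀ D p v w)

theorem connectionAt_invConnection_eq (B : E →ₗ[ℝ] E →ₗ[ℝ] E) (p : G) :
    connectionAt (invConnection I G B) p = fun x y => B x y :=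
  funext fun x => funext fun y => connectionAt_invConnection B p x y

theorem coframe_invConnection (B : E →ₗ[ℝ] E →ₗ[ℝ] E) (X Y : (p : G) → TangentSpace I p) (p : G) :
    (toIdentity p (invConnection I G B Y p (X p)) : E)
      = mvfderiv I (coframe Y) p (X p) + B (coframe X p) (coframe Y p) :=
  toIdentity_fromIdentity p _

/-- On invariant fields g is constant, so the derivative in the metric condition vanishes at every
point. -/
theorem isMetric_connectionAt {D : CovariantDerivative I E (TangentSpace I : G → Type _)}
    (h : (invTensor I G J₀ g₀).IsMetric D) (p : G) :
    (lieData I G J₀ g₀).IsMetric (connectionAt D p) := by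
  intro x y z
  have h1 := h (invField I x) (invField I y) (invField I z) (isSmoothField_invField x)
    (isSmoothField_invField y) (isSmoothField_invField z) p
  rw [invTensor_g_coframe, coframe_invField, coframe_invField, mvfderiv_const] at h1
  have hinv : ∀ x : E, (toIdentity p (invField I x p) : E) = x :=
    fun x => toIdentity_fromIdentity p x
  refine Eq.trans (congrArg₂ (· + ·) ?_ ?_) h1.symm
  · exact congrArg (fun a : E => g₀ (connectionAt D p x y) a) (hinv z).symm
  · exact congrArg (fun a : E => g₀ a (connectionAt D p x z)) (hinv y).symm

theorem isMetric_invConnection {B : E →ₗ[ℝ] E →ₗ[ℝ] E}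
    (h : (lieData I G J₀ g₀).IsMetric fun x y => B x y) :
    (invTensor I G J₀ g₀).IsMetric (invConnection I G B) := by
  intro X Y Z hX hY hZ p
  have h1 := (hasMFDerivAt_bilinear g₀ (hY.coframe_mdifferentiableAt p)
    (hZ.coframe_mdifferentiableAt p)).2 (X p)
  have h2 : g₀ (B (coframe X p) (coframe Y p)) (coframe Z p)
    + g₀ (coframe Y p) (B (coframe X p) (coframe Z p)) = 0 := h _ _ _
  have h3 : g₀ (mvfderiv I (coframe Y) p (X p) + B (coframe X p) (coframe Y p)) (coframe Z p)
      + g₀ (coframe Y p) (mvfderiv I (coframe Z) p (X p) + B (coframe X p) (coframe Z p))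
      = mvfderiv I (fun p => g₀ (coframe Y p) (coframe Z p)) p (X p) := by
    rw [h1, map_add, map_add, LinearMap.add_apply]
    linarith
  refine h3.symm.trans (congrArg₂ (· + ·) ?_ ?_)
  · exact congrArg (fun a : E => g₀ a (coframe Z p)) (coframe_invConnection B X Y p).symm
  · exact congrArg (fun a : E => g₀ (coframe Y p) a) (coframe_invConnection B X Z p).symm

theorem isHKTConnection_connectionAt {D : CovariantDerivative I E (TangentSpace I : G → Type _)}
    (h : (invTensor I G J₀ g₀).IsHKTConnection D) (p : G) :
    (lieData I G J₀ g₀).IsHKTConnection (connectionAt D p) := by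
  have hT : ∀ x y z : E, (invTensor I G J₀ g₀).torsionForm D p (invField I x p) (invField I y p)
      (invField I z p) = (lieData I G J₀ g₀).torsionForm (connectionAt D p) x y z := by
    intro x y z
    have hinv : ∀ x : E, (toIdentity p (invField I x p) : E) = x :=
      fun x => toIdentity_fromIdentity p x
    have h1 := torsionForm_invTensor (J₀ := J₀) (g₀ := g₀) D p (invField I x p) (invField I y p)
      (invField I z p)
    refine h1.trans ?_
    rw [hinv, hinv, hinv]
  refine ⟨isMetric_connectionAt h.metric p, fun α x y => ?_, fun x y z => ?_, fun x y z => ?_⟩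
  · have h1 := h.quaternionic α (invField I x) (invField I y) (isSmoothField_invField x)
      (isSmoothField_invField y) p
    rw [invTensor_J_invField] at h1
    exact (congrArg (toIdentity p) h1).trans (toIdentity_invTensor_J α p _)
  · rw [← hT, ← hT]; exact h.skew_left _ _ _ _
  · rw [← hT, ← hT]; exact h.skew_right _ _ _ _

theorem isHKTConnection_invConnection {B : E →ₗ[ℝ] E →ₗ[ℝ] E}
    (h : (lieData I G J₀ g₀).IsHKTConnection fun x y => B x y) :
    (invTensor I G J₀ g₀).IsHKTConnection (invConnection I G B) := by
  refine ⟨isSmoothConnection_invConnection B, isMetric_invConnection h.metric,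
    fun α X Y hX hY p => ?_, fun p u v w => ?_, fun p u v w => ?_⟩
  · have h1 := coframe_invConnection (I := I) B X (fun p => (invTensor I G J₀ g₀).J α p (Y p)) p
    rw [coframe_invTensor_J] at h1
    have h2 : (mvfderiv I (fun p => J₀ α (coframe Y p)) p (X p)
        + B (coframe X p) (J₀ α (coframe Y p)) : E)
        = J₀ α (mvfderiv I (coframe Y) p (X p) + B (coframe X p) (coframe Y p)) := by
      rw [map_add]
      exact congrArg₂ (· + ·) (mvfderiv_linear_comp (hY.coframe_mdifferentiableAt p) (J₀ α) (X p))
        (h.quaternionic α (coframe X p) (coframe Y p))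
    have h3 : (toIdentity p ((invTensor I G J₀ g₀).J α p (invConnection I G B Y p (X p))) : E)
        = J₀ α (mvfderiv I (coframe Y) p (X p) + B (coframe X p) (coframe Y p)) :=
      (toIdentity_invTensor_J α p _).trans (congrArg (J₀ α) (coframe_invConnection B X Y p))
    exact toIdentity_injective (h1.trans (h2.trans h3.symm))
  · rw [torsionForm_invTensor, torsionForm_invTensor, connectionAt_invConnection_eq]
    exact h.skew_left _ _ _
  · rw [torsionForm_invTensor, torsionForm_invTensor, connectionAt_invConnection_eq]
    exact h.skew_right _ _ _

theorem isLeviCivita_connectionAt {D : CovariantDerivative I E (TangentSpace I : G → Type _)}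
    (h : (invTensor I G J₀ g₀).IsLeviCivita D) (p : G) :
    (lieData I G J₀ g₀).IsLeviCivita (connectionAt D p) := by
  refine ⟨isMetric_connectionAt h.metric p, fun x y => ?_⟩
  have hinv : ∀ x : E, (toIdentity p (invField I x p) : E) = x :=
    fun x => toIdentity_fromIdentity p x
  have h1 := toIdentity_torsion J₀ g₀ D p (invField I x p) (invField I y p)
  rw [h.torsion_free, hinv, hinv] at h1
  exact h1.symm.trans (map_zero (toIdentity p))

theorem isLeviCivita_invConnection {B : E →ₗ[ℝ] E →ₗ[ℝ] E}
    (h : (lieData I G J₀ g₀).IsLeviCivita fun x y => B x y) :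
    (invTensor I G J₀ g₀).IsLeviCivita (invConnection I G B) := by
  refine ⟨isSmoothConnection_invConnection B, isMetric_invConnection h.metric, fun p v w => ?_⟩
  refine toIdentity_injective ((toIdentity_torsion J₀ g₀ _ p v w).trans ?_)
  rw [connectionAt_invConnection_eq]
  exact (h.torsion_free _ _).trans (map_zero (toIdentity p)).symm

/-- Reading D at the identity gives the algebraic product; the invariant connection of a product
gives the converse. -/
theorem isHKT_invTensor_iff : (invTensor I G J₀ g₀).IsHKT ↔ (lieData I G J₀ g₀).IsHyperHermitian ∧
    ∃ B : E →ₗ[ℝ] E →ₗ[ℝ] E, (lieData I G J₀ g₀).IsHKTConnection fun x y => B x y := by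
  refine and_congr isHyperHermitian_invTensor_iff ⟨fun ⟨D, hD⟩ => ?_, fun ⟨B, hB⟩ =>
    ⟨_, isHKTConnection_invConnection hB⟩⟩
  obtain ⟨B, hB⟩ := exists_bilinear_connectionAt D 1
  exact ⟨B, hB ▸ isHKTConnection_connectionAt hD 1⟩

/-- For arbitrary smooth fields the derivatives of the coefficient functions cancel against those in
the brackets, leaving the algebraic expression evaluated pointwise on coframes. Hence testing
invariant fields is enough. -/
theorem isClosedTwo_kahlerForm_iff (h : (lieData I G J₀ g₀).IsHyperHermitian) (α : Fin 3) :
    IsClosedTwo ((invTensor I G J₀ g₀).kahlerForm α) ↔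
      ∀ x y z, (lieData I G J₀ g₀).dKahler α x y z = 0 := by
  let Ω : E →ₗ[ℝ] E →ₗ[ℝ] ℝ := g₀ ∘ₗ J₀ α
  have hΩ : ∀ x y, Ω x y = -Ω y x := fun x y =>
    (h.g_J_left α x y).trans (congrArg Neg.neg (h.g_symm _ _))
  have hk : ∀ (p : G) (v w : TangentSpace I p), (invTensor I G J₀ g₀).kahlerForm α p v w
      = Ω (toIdentity p v : E) (toIdentity p w : E) := fun p v w =>
    congrArg (fun a : E => g₀ a (toIdentity p w : E)) (toIdentity_invTensor_J α p v)
  have key : ∀ X Y Z : (p : G) → TangentSpace I p, IsSmoothField X → IsSmoothField Y →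
      IsSmoothField Z → ∀ p, extDerivTwo ((invTensor I G J₀ g₀).kahlerForm α) X Y Z p =
        (lieData I G J₀ g₀).dKahler α (coframe X p) (coframe Y p) (coframe Z p) := by
    intro X Y Z hX hY hZ p
    have hd : ∀ {Y Z : (p : G) → TangentSpace I p}, IsSmoothField Y → IsSmoothField Z →
        ∀ v, mvfderiv I (fun y => (invTensor I G J₀ g₀).kahlerForm α y (Y y) (Z y)) p v =
          Ω (mvfderiv I (coframe Y) p v) (coframe Z p)
            - Ω (mvfderiv I (coframe Z) p v) (coframe Y p) := by
      intro Y Z hY hZ v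
      have h1 := (hasMFDerivAt_bilinear Ω (hY.coframe_mdifferentiableAt p)
        (hZ.coframe_mdifferentiableAt p)).2 v
      rw [hΩ (coframe Y p)] at h1
      have h2 : (fun y => (invTensor I G J₀ g₀).kahlerForm α y (Y y) (Z y))
        = fun y => Ω (coframe Y y) (coframe Z y) := funext fun y => hk y _ _
      rw [h2, h1]
      ring
    have hb : ∀ {X Y Z : (p : G) → TangentSpace I p}, IsSmoothField X → IsSmoothField Y →
        (invTensor I G J₀ g₀).kahlerForm α p (mlieBracket I X Y p) (Z p) =
          Ω (mvfderiv I (coframe Y) p (X p)) (coframe Z p)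
          - Ω (mvfderiv I (coframe X) p (Y p)) (coframe Z p)
          + Ω ((lieData I G J₀ g₀).br (coframe X p) (coframe Y p)) (coframe Z p) := by
      intro X Y Z hX hY
      have h1 : Ω (coframe (mlieBracket I X Y) p) (coframe Z p)
          = Ω (mvfderiv I (coframe Y) p (X p)) (coframe Z p)
          - Ω (mvfderiv I (coframe X) p (Y p)) (coframe Z p)
          + Ω ((lieData I G J₀ g₀).br (coframe X p) (coframe Y p)) (coframe Z p) := by
        rw [coframe_mlieBracket_lieData J₀ g₀ hX hY p, map_add, map_sub, LinearMap.add_apply,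
          LinearMap.sub_apply]
      exact (hk p _ _).trans h1
    have h0 : (lieData I G J₀ g₀).dKahler α (coframe X p) (coframe Y p) (coframe Z p) =
        -Ω ((lieData I G J₀ g₀).br (coframe X p) (coframe Y p)) (coframe Z p)
        + Ω ((lieData I G J₀ g₀).br (coframe X p) (coframe Z p)) (coframe Y p)
        - Ω ((lieData I G J₀ g₀).br (coframe Y p) (coframe Z p)) (coframe X p) := rfl
    rw [extDerivTwo, hd hY hZ, hd hX hZ, hd hX hY, hb hX hY, hb hX hZ, hb hY hZ, h0]
    ring
  refine ⟨fun hc x y z => ?_, fun hc X Y Z hX hY hZ p => (key X Y Z hX hY hZ p).trans (hc _ _ _)⟩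
  have h1 := key (invField I x) (invField I y) (invField I z) (isSmoothField_invField x)
    (isSmoothField_invField y) (isSmoothField_invField z) 1
  rw [coframe_invField, coframe_invField, coframe_invField] at h1
  exact h1.symm.trans (hc _ _ _ (isSmoothField_invField x) (isSmoothField_invField y)
    (isSmoothField_invField z) 1)

theorem isHyperKahler_invTensor_iff : (invTensor I G J₀ g₀).IsHyperKahler ↔
    (lieData I G J₀ g₀).IsHyperHermitian ∧
      ∀ α x y z, (lieData I G J₀ g₀).dKahler α x y z = 0 := by
  constructor
  · rintro ⟨h, hc⟩
    have h' := isHyperHermitian_invTensor_iff.1 h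
    exact ⟨h', fun α => (isClosedTwo_kahlerForm_iff h' α).1 (hc α)⟩
  · rintro ⟨h, hc⟩
    exact ⟨isHyperHermitian_invTensor_iff.2 h, fun α => (isClosedTwo_kahlerForm_iff h α).2 (hc α)⟩

end InvariantConnections
end HKT

namespace HKT
open VectorField Filter Topology

/-! ### Closed torsion forms and coclosed Kähler forms. -/

section InvariantForms

variable {E : Type*} [NormedAddCommGroup E] [NormedSpace ℝ E] [FiniteDimensional ℝ E]
  {H : Type*} [TopologicalSpace H] {I : ModelWithCorners ℝ E H}
  {G : Type*} [TopologicalSpace G] [ChartedSpace H G] [Group G] [LieGroup I ∞ G]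
  {J₀ : Fin 3 → E →ₗ[ℝ] E} {g₀ : E →ₗ[ℝ] E →ₗ[ℝ] ℝ}

/-- Factoring c as g₀(x, τ(y, z)) reduces the product rule for a trilinear form to two bilinear
ones. The four differentiated terms give twelve derivatives, which cancel against the twelve from
the six brackets. -/
theorem extDerivThree_invariant {c : E → E → E → ℝ} (τ : E →ₗ[ℝ] E →ₗ[ℝ] E)
    (hc : ∀ x y z, c x y z = g₀ x (τ y z)) (hl : ∀ x y z, c x y z = -c y x z)
    (hr : ∀ x y z, c x y z = -c x z y) {X Y Z W : (p : G) → TangentSpace I p}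
    (hX : IsSmoothField X) (hY : IsSmoothField Y) (hZ : IsSmoothField Z) (hW : IsSmoothField W)
    (p : G) :
    extDerivThree (fun (p : G) (u v w : TangentSpace I p) =>
        c (toIdentity p u : E) (toIdentity p v : E) (toIdentity p w : E)) X Y Z W p =
      (lieData I G J₀ g₀).dThree c (coframe X p) (coframe Y p) (coframe Z p) (coframe W p) := by
  have hadd : ∀ x x' y z, c (x + x') y z = c x y z + c x' y z := fun x x' y z => by
    rw [hc, hc, hc, map_add, LinearMap.add_apply]
  have hsub : ∀ x x' y z, c (x - x') y z = c x y z - c x' y z := fun x x' y z => by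
    rw [hc, hc, hc, map_sub, LinearMap.sub_apply]
  have hd : ∀ {X Y Z : (p : G) → TangentSpace I p}, IsSmoothField X → IsSmoothField Y →
      IsSmoothField Z → ∀ v,
      mvfderiv I (fun p => c (coframe X p) (coframe Y p) (coframe Z p)) p v =
        c (mvfderiv I (coframe X) p v) (coframe Y p) (coframe Z p)
          - c (mvfderiv I (coframe Y) p v) (coframe X p) (coframe Z p)
          + c (mvfderiv I (coframe Z) p v) (coframe X p) (coframe Y p) := by
    intro X Y Z hX hY hZ v
    have h1 := hasMFDerivAt_bilinear τ (hY.coframe_mdifferentiableAt p)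
      (hZ.coframe_mdifferentiableAt p)
    have h2 := (hasMFDerivAt_bilinear g₀ (hX.coframe_mdifferentiableAt p) h1.1).2 v
    rw [h1.2, map_add, ← hc, ← hc, ← hc] at h2
    have h3 : (fun p => c (coframe X p) (coframe Y p) (coframe Z p)) =
        fun p => g₀ (coframe X p) (τ (coframe Y p) (coframe Z p)) :=
      funext fun p => hc _ _ _
    rw [h3, h2, hl (coframe X p) (mvfderiv I (coframe Y) p v),
      hr (coframe X p) (coframe Y p), hl (coframe X p) (mvfderiv I (coframe Z) p v)]
    ring
  have hb : ∀ {X Y : (p : G) → TangentSpace I p}, IsSmoothField X → IsSmoothField Y → ∀ z w,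
      c (coframe (mlieBracket I X Y) p) z w =
        c (mvfderiv I (coframe Y) p (X p)) z w - c (mvfderiv I (coframe X) p (Y p)) z w
          + c ((lieData I G J₀ g₀).br (coframe X p) (coframe Y p)) z w := by
    intro X Y hX hY z w
    rw [← hsub, ← hadd]
    exact congrArg (fun a => c a z w) (coframe_mlieBracket_lieData J₀ g₀ hX hY p)
  let d (X Y Z V : (p : G) → TangentSpace I p) : ℝ :=
    mvfderiv I (fun p => c (coframe X p) (coframe Y p) (coframe Z p)) p (V p)
  let b (X Y Z W : (p : G) → TangentSpace I p) : ℝ :=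
    c (coframe (mlieBracket I X Y) p) (coframe Z p) (coframe W p)
  have h0 : extDerivThree (fun (p : G) (u v w : TangentSpace I p) =>
        c (toIdentity p u : E) (toIdentity p v : E) (toIdentity p w : E)) X Y Z W p =
      d Y Z W X - d X Z W Y + d X Y W Z - d X Y Z W - b X Y Z W + b X Z Y W - b X W Y Z
        - b Y Z X W + b Y W X Z - b Z W X Y := rfl
  rw [h0]
  simp only [d, b]
  rw [hd hY hZ hW, hd hX hZ hW, hd hX hY hW, hd hX hY hZ, hb hX hY, hb hX hZ,
    hb hX hW, hb hY hZ, hb hY hW, hb hZ hW, LieData.dThree]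
  ring

theorem isClosedThree_invariant_iff {c : E → E → E → ℝ} (τ : E →ₗ[ℝ] E →ₗ[ℝ] E)
    (hc : ∀ x y z, c x y z = g₀ x (τ y z)) (hl : ∀ x y z, c x y z = -c y x z)
    (hr : ∀ x y z, c x y z = -c x z y) :
    IsClosedThree (fun (p : G) (u v w : TangentSpace I p) =>
        c (toIdentity p u : E) (toIdentity p v : E) (toIdentity p w : E)) ↔
      ∀ x y z w, (lieData I G J₀ g₀).dThree c x y z w = 0 := by
  constructor
  · intro h x y z w
    have hs : ∀ x : E, IsSmoothField (invField I x : (p : G) → TangentSpace I p) :=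
      isSmoothField_invField
    have h1 := extDerivThree_invariant (J₀ := J₀) τ hc hl hr (hs x) (hs y) (hs z) (hs w) 1
    rw [coframe_invField, coframe_invField, coframe_invField, coframe_invField] at h1
    exact h1.symm.trans (h _ _ _ _ (hs x) (hs y) (hs z) (hs w) 1)
  · intro h X Y Z W hX hY hZ hW p
    exact (extDerivThree_invariant (J₀ := J₀) τ hc hl hr hX hY hZ hW p).trans (h _ _ _ _)

/-- Uniqueness of torsion, applied to `connectionAt D p` at every p, identifies the torsion form of
any HKT connection with one invariant form. Closedness is therefore independent of D; the index 0 is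
an arbitrary choice. -/
theorem isClosedThree_torsionForm_iff (h : (lieData I G J₀ g₀).IsHyperHermitian)
    {D : CovariantDerivative I E (TangentSpace I : G → Type _)}
    (hD : (invTensor I G J₀ g₀).IsHKTConnection D) :
    IsClosedThree ((invTensor I G J₀ g₀).torsionForm D) ↔
      ∀ x y z w, (lieData I G J₀ g₀).dThree ((lieData I G J₀ g₀).bismutForm 0) x y z w = 0 := by
  let A := lieData I G J₀ g₀
  obtain ⟨B, hB⟩ := exists_bilinear_connectionAt D 1
  have hB' : A.IsHKTConnection fun x y => B x y := hB ▸ isHKTConnection_connectionAt hD 1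
  have hT := hB'.torsionForm_eq h 0
  have h1 : (invTensor I G J₀ g₀).torsionForm D = fun (p : G) (u v w : TangentSpace I p) =>
      A.bismutForm 0 (toIdentity p u : E) (toIdentity p v : E) (toIdentity p w : E) := by
    funext p u v w
    exact (torsionForm_invTensor D p u v w).trans
      ((isHKTConnection_connectionAt hD p).torsionForm_eq h 0 _ _ _)
  rw [h1]
  -- This bilinear map is the torsion of the product at the identity, which supplies the
  -- factorization through g₀.
  refine isClosedThree_invariant_iff (B - B.flip - A.br) (fun x y z => (hT x y z).symm)
    (fun x y z => ?_) (fun x y z => ?_)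
  · rw [← hT, ← hT]; exact hB'.skew_left x y z
  · rw [← hT, ← hT]; exact hB'.skew_right x y z

theorem isStrongHKT_invTensor_iff (hS : (invTensor I G J₀ g₀).IsHKT) :
    (invTensor I G J₀ g₀).IsStrongHKT ↔
      ∀ x y z w, (lieData I G J₀ g₀).dThree ((lieData I G J₀ g₀).bismutForm 0) x y z w = 0 := by
  have h := isHyperHermitian_invTensor_iff.1 hS.1
  refine ⟨fun ⟨_, D, hD, hc⟩ => (isClosedThree_torsionForm_iff h hD).1 hc, fun hc => ?_⟩
  obtain ⟨D, hD⟩ := hS.2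
  exact ⟨hS.1, D, hD, (isClosedThree_torsionForm_iff h hD).2 hc⟩

/-- Since closedness is the same for all HKT connections, weak is the negation of strong despite the
existential quantifier. -/
theorem isWeakHKT_invTensor_iff (hS : (invTensor I G J₀ g₀).IsHKT) :
    (invTensor I G J₀ g₀).IsWeakHKT ↔
      ¬ ∀ x y z w, (lieData I G J₀ g₀).dThree ((lieData I G J₀ g₀).bismutForm 0) x y z w = 0 := by
  have h := isHyperHermitian_invTensor_iff.1 hS.1
  refine ⟨fun ⟨_, D, hD, hc⟩ => mt (isClosedThree_torsionForm_iff h hD).2 hc, fun hc => ?_⟩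
  obtain ⟨D, hD⟩ := hS.2
  exact ⟨hS.1, D, hD, mt (isClosedThree_torsionForm_iff h hD).1 hc⟩

theorem isCoclosed_connectionAt {D : CovariantDerivative I E (TangentSpace I : G → Type _)}
    {α : Fin 3} (h : (invTensor I G J₀ g₀).IsCoclosed D ((invTensor I G J₀ g₀).kahlerForm α))
    (p : G) : (lieData I G J₀ g₀).IsCoclosed (connectionAt D p) α := by
  intro e he y
  have hinv : ∀ (p : G) (x : E), (toIdentity p (invField I x p) : E) = x :=
    fun p x => toIdentity_fromIdentity p x
  have hk : ∀ (p : G) (v w : TangentSpace I p), (invTensor I G J₀ g₀).kahlerForm α p v w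
      = g₀ (J₀ α (toIdentity p v : E)) (toIdentity p w : E) := fun p v w =>
    congrArg (fun a : E => g₀ a (toIdentity p w : E)) (toIdentity_invTensor_J α p v)
  have h1 := h p (fun i => invField I (e i)) (invField I y) (fun i => isSmoothField_invField (e i))
    (isSmoothField_invField y) fun i j =>
      (congrArg₂ (fun a b => g₀ a b) (hinv p (e i)) (hinv p (e j))).trans (he i j)
  have h2 : ∀ x : E, covDerivTwo D ((invTensor I G J₀ g₀).kahlerForm α) (invField I x)
      (invField I x) (invField I y) p
      = -(lieData I G J₀ g₀).covKahler (connectionAt D p) α x x y := by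
    intro x
    have h3 : (fun q : G => (invTensor I G J₀ g₀).kahlerForm α q (invField I x q) (invField I y q))
        = fun _ => g₀ (J₀ α x) y := funext fun q => by rw [hk, hinv, hinv]
    have h4 : (invTensor I G J₀ g₀).kahlerForm α p (D (invField I x) p (invField I x p))
        (invField I y p) = g₀ (J₀ α (connectionAt D p x x)) y := by
      rw [hk, hinv]; rfl
    have h5 : (invTensor I G J₀ g₀).kahlerForm α p (invField I x p)
        (D (invField I y) p (invField I x p)) = g₀ (J₀ α x) (connectionAt D p x y) := by
      rw [hk, hinv]; rfl
    have h6 : (lieData I G J₀ g₀).covKahler (connectionAt D p) α x x y =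
      g₀ (J₀ α (connectionAt D p x x)) y + g₀ (J₀ α x) (connectionAt D p x y) := rfl
    rw [covDerivTwo, h3, h4, h5, mvfderiv_const, h6]
    change 0 - _ - _ = _
    ring
  have h7 : -∑ i, covDerivTwo D ((invTensor I G J₀ g₀).kahlerForm α) (invField I (e i))
      (invField I (e i)) (invField I y) p
      = ∑ i, (lieData I G J₀ g₀).covKahler (connectionAt D p) α (e i) (e i) y := by
    simp only [h2, Finset.sum_neg_distrib, neg_neg]
  exact h7.symm.trans h1

/-- The test frames are orthonormal only at p, but ∇ω is tensorial: the derivatives of their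
coefficients cancel and only the values at p matter. -/
theorem isCoclosed_invConnection {B : E →ₗ[ℝ] E →ₗ[ℝ] E} {α : Fin 3}
    (h : (lieData I G J₀ g₀).IsCoclosed (fun x y => B x y) α) :
    (invTensor I G J₀ g₀).IsCoclosed (invConnection I G B)
      ((invTensor I G J₀ g₀).kahlerForm α) := by
  intro p e Y he hY horth
  have hk : ∀ (p : G) (v w : TangentSpace I p), (invTensor I G J₀ g₀).kahlerForm α p v w
      = g₀ (J₀ α (toIdentity p v : E)) (toIdentity p w : E) := fun p v w =>
    congrArg (fun a : E => g₀ a (toIdentity p w : E)) (toIdentity_invTensor_J α p v)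
  have h2 : ∀ X : (p : G) → TangentSpace I p, IsSmoothField X →
      covDerivTwo (invConnection I G B) ((invTensor I G J₀ g₀).kahlerForm α) X X Y p
      = -(lieData I G J₀ g₀).covKahler (fun x y => B x y) α (coframe X p) (coframe X p)
          (coframe Y p) := by
    intro X hX
    have h3 := (hasMFDerivAt_bilinear (g₀ ∘ₗ J₀ α) (hX.coframe_mdifferentiableAt p)
      (hY.coframe_mdifferentiableAt p)).2 (X p)
    have h4 : (fun q : G => (invTensor I G J₀ g₀).kahlerForm α q (X q) (Y q))
        = fun q => (g₀ ∘ₗ J₀ α) (coframe X q) (coframe Y q) := funext fun q => hk q _ _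
    have h5 : (invTensor I G J₀ g₀).kahlerForm α p (invConnection I G B X p (X p)) (Y p)
        = g₀ (J₀ α (mvfderiv I (coframe X) p (X p) + B (coframe X p) (coframe X p)))
          (coframe Y p) :=
      (hk p _ _).trans (congrArg (fun a : E => g₀ (J₀ α a) (coframe Y p))
        (coframe_invConnection B X X p))
    have h6 : (invTensor I G J₀ g₀).kahlerForm α p (X p) (invConnection I G B Y p (X p))
        = g₀ (J₀ α (coframe X p))
          (mvfderiv I (coframe Y) p (X p) + B (coframe X p) (coframe Y p)) :=
      (hk p _ _).trans (congrArg (fun a : E => g₀ (J₀ α (coframe X p)) a)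
        (coframe_invConnection B X Y p))
    have h7 : (lieData I G J₀ g₀).covKahler (fun x y => B x y) α (coframe X p) (coframe X p)
        (coframe Y p) = g₀ (J₀ α (B (coframe X p) (coframe X p))) (coframe Y p)
          + g₀ (J₀ α (coframe X p)) (B (coframe X p) (coframe Y p)) := rfl
    rw [covDerivTwo, h4, h3, h5, h6, h7]
    simp only [LinearMap.comp_apply, map_add, LinearMap.add_apply]
    ring
  have h8 := h (fun i => coframe (e i) p) horth (coframe Y p)
  rw [Finset.sum_congr rfl fun i _ => h2 (e i) (he i), Finset.sum_neg_distrib, neg_neg]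
  exact h8

theorem isBalanced_invTensor_iff : (invTensor I G J₀ g₀).IsBalanced ↔
    (lieData I G J₀ g₀).IsHyperHermitian ∧ ∃ B : E →ₗ[ℝ] E →ₗ[ℝ] E,
      (lieData I G J₀ g₀).IsLeviCivita (fun x y => B x y) ∧
        ∀ α, (lieData I G J₀ g₀).IsCoclosed (fun x y => B x y) α := by
  refine and_congr isHyperHermitian_invTensor_iff ⟨fun ⟨D, hD, hc⟩ => ?_, fun ⟨B, hB, hc⟩ =>
    ⟨_, isLeviCivita_invConnection hB, fun α => isCoclosed_invConnection (hc α)⟩⟩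
  obtain ⟨B, hB⟩ := exists_bilinear_connectionAt D 1
  exact ⟨B, hB ▸ isLeviCivita_connectionAt hD 1, fun α => hB ▸ isCoclosed_connectionAt (hc α) 1⟩

end InvariantForms
end HKT

namespace HKT

/-! ### Left-invariant tensors are determined by their values at the identity. -/

section LeftInvariance

variable {E : Type*} [NormedAddCommGroup E] [NormedSpace ℝ E]
  {H : Type*} [TopologicalSpace H] {I : ModelWithCorners ℝ E H}
  {G : Type*} [TopologicalSpace G] [ChartedSpace H G] [Group G] [LieGroup I ∞ G]

theorem toIdentity_mul_left (a x : G) (v : TangentSpace I x) :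
    (toIdentity (a * x) (mfderiv I I (a * ·) x v) : E) = toIdentity x v := by
  have h : (((a * x)⁻¹ * ·) ∘ (a * ·) : G → G) = (x⁻¹ * ·) := by
    ext y; simp [mul_assoc]
  have h1 := mfderiv_comp_apply (I' := I) (I'' := I) x
    (mdifferentiable_mul_left_top (I := I) (a * x)⁻¹ (a * x))
    (mdifferentiable_mul_left_top (I := I) a x) v
  have h2 : (mfderiv I I (((a * x)⁻¹ * ·) ∘ (a * ·) : G → G) x v : E)
      = mfderiv I I (x⁻¹ * ·) x v :=
    congrArg (fun f : G → G => (mfderiv I I f x v : E)) h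
  exact h1.symm.trans h2

theorem isLeftInvariant_invTensor (J₀ : Fin 3 → E →ₗ[ℝ] E) (g₀ : E →ₗ[ℝ] E →ₗ[ℝ] ℝ) :
    (invTensor I G J₀ g₀).IsLeftInvariant := by
  refine ⟨fun α a x v => ?_, fun a x v w => ?_⟩
  · refine toIdentity_injective ((toIdentity_invTensor_J α (a * x) _).trans ?_)
    exact (congrArg (J₀ α) (toIdentity_mul_left a x v)).trans
      ((toIdentity_invTensor_J α x v).symm.trans (toIdentity_mul_left a x _).symm)
  · exact congrArg₂ (fun b c : E => g₀ b c) (toIdentity_mul_left a x v) (toIdentity_mul_left a x w)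

/-- Apply invariance to translation by p⁻¹ at p. -/
theorem TensorData.IsLeftInvariant.eq_invTensor {S : TensorData I G} (h : S.IsLeftInvariant) :
    S = invTensor I G (fun α => (S.J α (1 : G) : E →ₗ[ℝ] E))
      (S.g (1 : G) : E →ₗ[ℝ] E →ₗ[ℝ] ℝ) := by
  let J₀ : Fin 3 → E →ₗ[ℝ] E := fun α => (S.J α (1 : G) : E →ₗ[ℝ] E)
  let g₀ : E →ₗ[ℝ] E →ₗ[ℝ] ℝ := (S.g (1 : G) : E →ₗ[ℝ] E →ₗ[ℝ] ℝ)
  have hJ : ∀ α (p : G) (v : TangentSpace I p),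
      (toIdentity p (S.J α p v) : E) = J₀ α (toIdentity p v : E) :=
    fun α p v => (h.J_invariant α p⁻¹ p v).symm.trans
      -- Invariance lands at p⁻¹ * p. All tangent spaces are copies of E, so the tensor can be
      -- rewritten along p⁻¹ * p = 1 with its argument fixed.
      (congrArg (fun q : G => (S.J α q : E →ₗ[ℝ] E) (toIdentity p v : E)) (inv_mul_cancel p))
  have hg : ∀ (p : G) (v w : TangentSpace I p), S.g p v w
      = g₀ (toIdentity p v : E) (toIdentity p w : E) :=
    fun p v w => (h.g_invariant p⁻¹ p v w).symm.trans
      (congrArg (fun q : G => (S.g q : E →ₗ[ℝ] E →ₗ[ℝ] ℝ) (toIdentity p v : E)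
        (toIdentity p w : E)) (inv_mul_cancel p))
  have e1 : S.J = (invTensor I G J₀ g₀).J := by
    funext α p
    exact LinearMap.ext fun v => toIdentity_injective
      ((hJ α p v).trans (toIdentity_invTensor_J (J₀ := J₀) (g₀ := g₀) α p v).symm)
  have e2 : S.g = (invTensor I G J₀ g₀).g := by
    funext p
    exact LinearMap.ext fun v => LinearMap.ext fun w => hg p v w
  exact congrArg₂ TensorData.mk e1 e2

end LeftInvariance

/-! ### Transfer of the algebraic results to T_π G. -/

section Semidirect

variable {q : ℕ}

theorem isQuaternionicSpace_leftMul :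
    LieData.IsQuaternionicSpace fun α => (leftMul q (imagUnit α)).toLinearMap := by
  have hmul : ∀ (a b : ℍ[ℝ]) (v : HSpace q), leftMul q a (leftMul q b v) = leftMul q (a * b) v :=
    fun a b v => smul_smul a b v
  have hneg : ∀ (a : ℍ[ℝ]) (v : HSpace q), leftMul q (-a) v = -leftMul q a v :=
    fun a v => neg_smul a v
  refine ⟨fun α v => ?_, fun v => ?_, fun v => ?_, inner_leftMul_imagUnit⟩
  · refine (hmul _ _ v).trans ?_
    have : imagUnit α * imagUnit α = -1 := by
      refine Quaternion.ext _ _ ?_ ?_ ?_ ?_ <;>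
        simp only [Quaternion.re_mul, Quaternion.imI_mul, Quaternion.imJ_mul, Quaternion.imK_mul] <;>
        fin_cases α <;> simp [imagUnit]
    rw [this, hneg]
    exact congrArg Neg.neg (one_smul ℍ[ℝ] v)
  · refine (hmul _ _ v).trans ?_
    have : imagUnit 0 * imagUnit 1 = imagUnit 2 := by
      refine Quaternion.ext _ _ ?_ ?_ ?_ ?_ <;>
        simp only [Quaternion.re_mul, Quaternion.imI_mul, Quaternion.imJ_mul, Quaternion.imK_mul] <;>
        simp [imagUnit]
    rw [this]
    rfl
  · refine (hmul _ _ v).trans ?_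
    have : imagUnit 1 * imagUnit 0 = -imagUnit 2 := by
      refine Quaternion.ext _ _ ?_ ?_ ?_ ?_ <;>
        simp only [Quaternion.re_mul, Quaternion.imI_mul, Quaternion.imJ_mul, Quaternion.imK_mul,
          Quaternion.re_neg, Quaternion.imI_neg, Quaternion.imJ_neg, Quaternion.imK_neg] <;>
        simp [imagUnit]
    rw [this]
    exact hneg _ v

variable {E : Type*} [NormedAddCommGroup E] [NormedSpace ℝ E]
  {H : Type*} [TopologicalSpace H] {I : ModelWithCorners ℝ E H}
  {G : Type*} [TopologicalSpace G] [ChartedSpace H G] [Group G]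

/-- The differential of a quaternionic representation as a plain bilinear map. -/
def QuaternionicRep.derivMap (π : QuaternionicRep I G q) : E →ₗ[ℝ] HSpace q →ₗ[ℝ] HSpace q :=
  ContinuousLinearMap.coeLM ℝ ∘ₗ π.deriv.toLinearMap

variable [FiniteDimensional ℝ E] [LieGroup I ∞ G]

/-- The endomorphisms and metric agree by definition; the content is the bracket formula for the
semidirect product. -/
theorem lieData_extend (π : QuaternionicRep I G q) (J₀ : Fin 3 → E →ₗ[ℝ] E)
    (g₀ : E →ₗ[ℝ] E →ₗ[ℝ] ℝ) :
    lieData (I.prod 𝓘(ℝ, HSpace q)) (TGroup π)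
      (fun α => LinearMap.prodMap (J₀ α) (leftMul q (imagUnit α)).toLinearMap)
      (g₀.compl₁₂ (LinearMap.fst ℝ E (HSpace q)) (LinearMap.fst ℝ E (HSpace q))
        + (innerₗ (HSpace q)).compl₁₂ (LinearMap.snd ℝ E (HSpace q))
          (LinearMap.snd ℝ E (HSpace q))) =
    (lieData I G J₀ g₀).semidirect (fun α => (leftMul q (imagUnit α)).toLinearMap)
      π.derivMap := by
  have hc : CompleteSpace E := FiniteDimensional.complete ℝ E
  have hb : bracketMap (I.prod 𝓘(ℝ, HSpace q)) (TGroup π)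
      = ((lieData I G J₀ g₀).semidirect (fun α => (leftMul q (imagUnit α)).toLinearMap)
        π.derivMap).br :=
    LinearMap.ext fun z => LinearMap.ext fun z' => TGroup.bracketMap_eq π z z'
  unfold lieData LieData.semidirect
  congr 1

omit [FiniteDimensional ℝ E] [LieGroup I ∞ G] in
theorem QuaternionicRep.derivMap_leftMul (π : QuaternionicRep I G q) (α : Fin 3) (x : E)
    (v : HSpace q) : π.derivMap x ((leftMul q (imagUnit α)).toLinearMap v)
      = (leftMul q (imagUnit α)).toLinearMap (π.derivMap x v) :=
  π.deriv_leftMul x (imagUnit α) v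

variable (I G) in
/-- The structure on `T_π G` extending the left-invariant structure with values `J₀, g₀`. -/
def invTensorExtend (J₀ : Fin 3 → E →ₗ[ℝ] E) (g₀ : E →ₗ[ℝ] E →ₗ[ℝ] ℝ) (π : QuaternionicRep I G q) :
    TensorData (I.prod 𝓘(ℝ, HSpace q)) (TGroup π) :=
  invTensor (I.prod 𝓘(ℝ, HSpace q)) (TGroup π)
    (fun α => LinearMap.prodMap (J₀ α) (leftMul q (imagUnit α)).toLinearMap)
    (g₀.compl₁₂ (LinearMap.fst ℝ E (HSpace q)) (LinearMap.fst ℝ E (HSpace q))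
      + (innerₗ (HSpace q)).compl₁₂ (LinearMap.snd ℝ E (HSpace q)) (LinearMap.snd ℝ E (HSpace q)))

variable {J₀ : Fin 3 → E →ₗ[ℝ] E} {g₀ : E →ₗ[ℝ] E →ₗ[ℝ] ℝ}

theorem isHyperHermitian_invTensorExtend (π : QuaternionicRep I G q)
    (h : (lieData I G J₀ g₀).IsHyperHermitian) :
    (invTensorExtend I G J₀ g₀ π).IsHyperHermitian := by
  rw [invTensorExtend, isHyperHermitian_invTensor_iff, lieData_extend]
  exact h.semidirect isQuaternionicSpace_leftMul π.derivMap_leftMul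

/-- On the Lie algebra: compression and forced skewness give one direction, extension of the
connection the other. -/
theorem isHKT_invTensorExtend_iff [I.Boundaryless] [ConnectedSpace G] (π : QuaternionicRep I G q)
    (h : (lieData I G J₀ g₀).IsHyperHermitian) : (invTensorExtend I G J₀ g₀ π).IsHKT ↔
      (invTensor I G J₀ g₀).IsHKT ∧ ∀ a : G, π.toHom a ∈ Sp q := by
  have h' := h.semidirect isQuaternionicSpace_leftMul π.derivMap_leftMul
  rw [invTensorExtend, isHKT_invTensor_iff, lieData_extend, isHKT_invTensor_iff,
    π.mem_Sp_iff_deriv_skew]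
  constructor
  · rintro ⟨-, B, hB⟩
    exact ⟨⟨h, _, hB.restrict⟩, hB.skew h isQuaternionicSpace_leftMul π.derivMap_leftMul⟩
  · rintro ⟨⟨-, B, hB⟩, hskew⟩
    exact ⟨h', _, hB.extend π.derivMap_leftMul hskew⟩

theorem closed_bismutForm_semidirect_iff (π : QuaternionicRep I G q)
    (hskew : ∀ x v w, inner ℝ (π.derivMap x v) w = -inner ℝ v (π.derivMap x w)) :
    (∀ x y z w, ((lieData I G J₀ g₀).semidirect (fun α => (leftMul q (imagUnit α)).toLinearMap)
        π.derivMap).dThree (((lieData I G J₀ g₀).semidirect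
          (fun α => (leftMul q (imagUnit α)).toLinearMap) π.derivMap).bismutForm 0) x y z w = 0) ↔
      ∀ x y z w, (lieData I G J₀ g₀).dThree ((lieData I G J₀ g₀).bismutForm 0) x y z w = 0 := by
  have hb := LieData.bismutForm_semidirect (A := lieData I G J₀ g₀) isQuaternionicSpace_leftMul
    π.derivMap_leftMul hskew 0
  constructor
  · intro hc x y z w
    exact (LieData.dThree_semidirect hb (x, 0) (y, 0) (z, 0) (w, 0)).symm.trans (hc _ _ _ _)
  · intro hc x y z w
    exact (LieData.dThree_semidirect hb x y z w).trans (hc _ _ _ _)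

theorem isStrongHKT_invTensorExtend_iff (π : QuaternionicRep I G q)
    (hT : (invTensorExtend I G J₀ g₀ π).IsHKT) (hS : (invTensor I G J₀ g₀).IsHKT)
    (hskew : ∀ x v w, inner ℝ (π.derivMap x v) w = -inner ℝ v (π.derivMap x w)) :
    (invTensorExtend I G J₀ g₀ π).IsStrongHKT ↔ (invTensor I G J₀ g₀).IsStrongHKT := by
  refine (isStrongHKT_invTensor_iff hT).trans (Iff.trans ?_ (isStrongHKT_invTensor_iff hS).symm)
  rw [lieData_extend]
  exact closed_bismutForm_semidirect_iff π hskew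

theorem isWeakHKT_invTensorExtend_iff (π : QuaternionicRep I G q)
    (hT : (invTensorExtend I G J₀ g₀ π).IsHKT) (hS : (invTensor I G J₀ g₀).IsHKT)
    (hskew : ∀ x v w, inner ℝ (π.derivMap x v) w = -inner ℝ v (π.derivMap x w)) :
    (invTensorExtend I G J₀ g₀ π).IsWeakHKT ↔ (invTensor I G J₀ g₀).IsWeakHKT := by
  refine (isWeakHKT_invTensor_iff hT).trans (Iff.trans ?_ (isWeakHKT_invTensor_iff hS).symm)
  rw [lieData_extend]
  exact not_congr (closed_bismutForm_semidirect_iff π hskew)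

theorem isHyperKahler_invTensorExtend_iff (π : QuaternionicRep I G q)
    (h : (lieData I G J₀ g₀).IsHyperHermitian)
    (hskew : ∀ x v w, inner ℝ (π.derivMap x v) w = -inner ℝ v (π.derivMap x w)) :
    (invTensorExtend I G J₀ g₀ π).IsHyperKahler ↔ (invTensor I G J₀ g₀).IsHyperKahler := by
  have h' := h.semidirect isQuaternionicSpace_leftMul π.derivMap_leftMul
  have hd := LieData.dKahler_semidirect (A := lieData I G J₀ g₀) isQuaternionicSpace_leftMul
    π.derivMap_leftMul hskew
  rw [invTensorExtend, isHyperKahler_invTensor_iff, lieData_extend, isHyperKahler_invTensor_iff]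
  constructor
  · rintro ⟨-, hc⟩
    exact ⟨h, fun α x y z => (hd α (x, 0) (y, 0) (z, 0)).symm.trans (hc _ _ _ _)⟩
  · rintro ⟨-, hc⟩
    exact ⟨h', fun α x y z => (hd α x y z).trans (hc _ _ _ _)⟩

theorem isBalanced_invTensorExtend_iff (π : QuaternionicRep I G q)
    (h : (lieData I G J₀ g₀).IsHyperHermitian)
    (hskew : ∀ x v w, inner ℝ (π.derivMap x v) w = -inner ℝ v (π.derivMap x w)) :
    (invTensorExtend I G J₀ g₀ π).IsBalanced ↔ (invTensor I G J₀ g₀).IsBalanced := by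
  have h' := h.semidirect isQuaternionicSpace_leftMul π.derivMap_leftMul
  rw [invTensorExtend, isBalanced_invTensor_iff, lieData_extend, isBalanced_invTensor_iff]
  exact and_congr (iff_of_true h' h) (LieData.exists_balanced_semidirect_iff h
    isQuaternionicSpace_leftMul π.derivMap_leftMul hskew)

theorem invTensorExtend_properties [I.Boundaryless] [ConnectedSpace G] {S : TensorData I G}
    (hS : S.IsHyperHermitian) (hinv : S = invTensor I G J₀ g₀) (π : QuaternionicRep I G q) :
    ((invTensorExtend I G J₀ g₀ π).IsHyperHermitian ∧
      (invTensorExtend I G J₀ g₀ π).IsLeftInvariant) ∧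
    ((invTensorExtend I G J₀ g₀ π).IsHKT ↔ S.IsHKT ∧ ∀ a : G, π.toHom a ∈ Sp q) ∧
    ((invTensorExtend I G J₀ g₀ π).IsHKT →
      ((invTensorExtend I G J₀ g₀ π).IsStrongHKT ↔ S.IsStrongHKT) ∧
      ((invTensorExtend I G J₀ g₀ π).IsWeakHKT ↔ S.IsWeakHKT) ∧
      ((invTensorExtend I G J₀ g₀ π).IsHyperKahler ↔ S.IsHyperKahler) ∧
      ((invTensorExtend I G J₀ g₀ π).IsBalanced ↔ S.IsBalanced)) := by
  subst hinv
  have h := isHyperHermitian_invTensor_iff.1 hS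
  have hiff := isHKT_invTensorExtend_iff π h
  refine ⟨⟨isHyperHermitian_invTensorExtend π h, isLeftInvariant_invTensor _ _⟩, hiff,
    fun hT => ?_⟩
  obtain ⟨hK, hSp⟩ := hiff.1 hT
  have hskew := π.mem_Sp_iff_deriv_skew.1 hSp
  exact ⟨isStrongHKT_invTensorExtend_iff π hT hK hskew, isWeakHKT_invTensorExtend_iff π hT hK hskew,
    isHyperKahler_invTensorExtend_iff π h hskew, isBalanced_invTensorExtend_iff π h hskew⟩

end Semidirect

end HKT

end

theorem theorem3p6 {E : Type*} [NormedAddCommGroup E] [NormedSpace ℝ E] [FiniteDimensional ℝ E]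
    {H : Type*} [TopologicalSpace H] {I : ModelWithCorners ℝ E H} [I.Boundaryless]
    {G : Type*} [TopologicalSpace G] [ChartedSpace H G] [Group G] [LieGroup I ∞ G]
    [ConnectedSpace G]
    (S : HKT.TensorData I G) (hS : S.IsHyperHermitian) (hinv : S.IsLeftInvariant)
    {q : ℕ} (π : HKT.QuaternionicRep I G q) :
    ((S.extend π).IsHyperHermitian ∧ (S.extend π).IsLeftInvariant) ∧
    ((S.extend π).IsHKT ↔ S.IsHKT ∧ ∀ a : G, π.toHom a ∈ HKT.Sp q) ∧
    ((S.extend π).IsHKT →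
      ((S.extend π).IsStrongHKT ↔ S.IsStrongHKT) ∧
      ((S.extend π).IsWeakHKT ↔ S.IsWeakHKT) ∧
      ((S.extend π).IsHyperKahler ↔ S.IsHyperKahler) ∧
      ((S.extend π).IsBalanced ↔ S.IsBalanced)) := by
  -- With J₀ and g₀ the values of S at 1, `S.extend π` unfolds to `invTensorExtend`.
  exact HKT.invTensorExtend_properties hS hinv.eq_invTensor π
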